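/- Let $G$ be the complex Heisenberg group of matrices $$\begin{pmatrix}1&z_1&z_2\\0&1&z_3\\0&0&1\end{pmatrix},\qquad z_1,z_2,z_3\in\mathbb C,$$ let $\Gamma\subset G$ be the lattice of matrices with entries in $\mathbb Z[i]$, and let $M=\Gamma\backslash G$ be the Iwasawa manifold, a smooth manifold of real dimension $6$. There exist a smooth Riemannian metric $g_0$ and a smooth almost complex structure $J_0$ on $M$ with $g_0(J_0\cdot,J_0\cdot)=g_0$, and with associated form $\omega_0=g_0(J_0\cdot,\cdot)$, such that the following hold. 0. $(g_0,J_0,\omega_0)$ is left-invariant (its pullback to $G$ is invariant under all left translations) and strictly quasi Kähler: $(d\omega_0)^{1,2}=0$, i.e. $d\omega_0(Z_1,\overline Z_2,\overline Z_3)=0$ for all $Z_1,Z_2,Z_3\in\Gamma(T^{1,0}M)$, but $d\omega_0\neq 0$ and $J_0$ is not integrable (its Nijenhuis tensor is not identically zero). 1. The Hermitian curvature vanishes: a canonical connection $\widetilde\nabla$ of $(g_0,J_0)$, i.e. a connection with $\widetilde\nabla g_0=0$, $\widetilde\nabla J_0=0$ and torsion with vanishing $(1,1)$-part, exists, and every such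 connection satisfies $$\widetilde R(X,Y,Z,W)=g_0\big(\widetilde\nabla_X\widetilde\nabla_YZ-\widetilde\nabla_Y\widetilde\nabla_XZ-\widetilde\nabla_{[X,Y]}Z,\,W\big)=0$$ for all smooth vector fields $X,Y,Z,W$ on $M$. 2. The Levi-Civita connection of $g_0$ exists, and the Riemann curvature tensor $R$ of $g_0$, extended complex multilinearly, satisfies the second Gray identity $(\mathrm G_2)$: $$R(Z_1,Z_2,Z_3,Z_4)=R(\overline Z_1,Z_2,Z_3,Z_4)=0\qquad\text{for all }Z_1,Z_2,Z_3,Z_4\in\Gamma(T^{1,0}M).$$ -/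

import Mathlib

open scoped Manifold ContDiff Topology

noncomputable section

/-- The complex Heisenberg group in its global coordinates `(z₁, z₂, z₃)`. -/
def HeisenbergC : Type := ℂ × ℂ × ℂ

namespace HeisenbergC

instance : TopologicalSpace HeisenbergC := inferInstanceAs (TopologicalSpace (ℂ × ℂ × ℂ))
instance : T2Space HeisenbergC := inferInstanceAs (T2Space (ℂ × ℂ × ℂ))
instance : LocallyCompactSpace HeisenbergC := inferInstanceAs (LocallyCompactSpace (ℂ × ℂ × ℂ))
instance : ChartedSpace (ℂ × ℂ × ℂ) HeisenbergC :=
  inferInstanceAs (ChartedSpace (ℂ × ℂ × ℂ) (ℂ × ℂ × ℂ))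
instance : IsManifold 𝓘(ℝ, ℂ × ℂ × ℂ) ∞ HeisenbergC :=
  inferInstanceAs (IsManifold 𝓘(ℝ, ℂ × ℂ × ℂ) ∞ (ℂ × ℂ × ℂ))

/-- The element with coordinates `z₁, z₂, z₃`. -/
def mk (z₁ z₂ z₃ : ℂ) : HeisenbergC := (z₁, z₂, z₃)
def z₁ (a : HeisenbergC) : ℂ := a.1
def z₂ (a : HeisenbergC) : ℂ := a.2.1
def z₃ (a : HeisenbergC) : ℂ := a.2.2

@[simp] theorem z₁_mk (a b c : ℂ) : (mk a b c).z₁ = a := rfl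
@[simp] theorem z₂_mk (a b c : ℂ) : (mk a b c).z₂ = b := rfl
@[simp] theorem z₃_mk (a b c : ℂ) : (mk a b c).z₃ = c := rfl

@[ext] theorem ext {a b : HeisenbergC} (h₁ : a.z₁ = b.z₁) (h₂ : a.z₂ = b.z₂)
    (h₃ : a.z₃ = b.z₃) : a = b := Prod.ext h₁ (Prod.ext h₂ h₃)

theorem continuous_z₁ : Continuous z₁ := continuous_fst
theorem continuous_z₂ : Continuous z₂ := continuous_fst.comp continuous_snd
theorem continuous_z₃ : Continuous z₃ := continuous_snd.comp continuous_snd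

/-- The unipotent upper triangular matrix with coordinates `z₁, z₂, z₃`. -/
def toMatrix (a : HeisenbergC) : Matrix (Fin 3) (Fin 3) ℂ :=
  !![1, a.z₁, a.z₂; 0, 1, a.z₃; 0, 0, 1]

instance : Mul HeisenbergC := ⟨fun a b => mk (a.z₁ + b.z₁) (a.z₂ + b.z₂ + a.z₁ * b.z₃) (a.z₃ + b.z₃)⟩
instance : One HeisenbergC := ⟨mk 0 0 0⟩
instance : Inv HeisenbergC := ⟨fun a => mk (-a.z₁) (a.z₁ * a.z₃ - a.z₂) (-a.z₃)⟩

@[simp] theorem mul_z₁ (a b : HeisenbergC) : (a * b).z₁ = a.z₁ + b.z₁ := rfl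
@[simp] theorem mul_z₂ (a b : HeisenbergC) : (a * b).z₂ = a.z₂ + b.z₂ + a.z₁ * b.z₃ := rfl
@[simp] theorem mul_z₃ (a b : HeisenbergC) : (a * b).z₃ = a.z₃ + b.z₃ := rfl
@[simp] theorem one_z₁ : (1 : HeisenbergC).z₁ = 0 := rfl
@[simp] theorem one_z₂ : (1 : HeisenbergC).z₂ = 0 := rfl
@[simp] theorem one_z₃ : (1 : HeisenbergC).z₃ = 0 := rfl
@[simp] theorem inv_z₁ (a : HeisenbergC) : a⁻¹.z₁ = -a.z₁ := rfl
@[simp] theorem inv_z₂ (a : HeisenbergC) : a⁻¹.z₂ = a.z₁ * a.z₃ - a.z₂ := rfl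
@[simp] theorem inv_z₃ (a : HeisenbergC) : a⁻¹.z₃ = -a.z₃ := rfl

instance : Group HeisenbergC :=
  Group.ofLeftAxioms (fun a b c => by ext <;> simp <;> ring) (fun a => by ext <;> simp)
    (fun a => by ext <;> simp)

theorem toMatrix_one : toMatrix 1 = 1 := by
  ext i j; fin_cases i <;> fin_cases j <;> simp [toMatrix]

theorem toMatrix_mul (a b : HeisenbergC) : toMatrix (a * b) = toMatrix a * toMatrix b := by
  ext i j
  fin_cases i <;> fin_cases j <;> simp [toMatrix, Matrix.mul_apply, Fin.sum_univ_three] <;> ring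

theorem toMatrix_injective : Function.Injective toMatrix := by
  intro a b h
  ext
  · simpa [toMatrix] using congrFun (congrFun h 0) 1
  · simpa [toMatrix] using congrFun (congrFun h 0) 2
  · simpa [toMatrix] using congrFun (congrFun h 1) 2

theorem range_toMatrix : Set.range toMatrix =
    {A | (∀ i, A i i = 1) ∧ ∀ i j, j < i → A i j = 0} := by
  ext A
  constructor
  · rintro ⟨a, rfl⟩
    constructor
    · intro i; fin_cases i <;> simp [toMatrix]
    · intro i j; fin_cases i <;> fin_cases j <;> simp [toMatrix]
  · rintro ⟨h1, h2⟩
    refine ⟨mk (A 0 1) (A 0 2) (A 1 2), ?_⟩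
    ext i j
    have := h1 0; have := h1 1; have := h1 2
    have := h2 1 0 (by decide); have := h2 2 0 (by decide); have := h2 2 1 (by decide)
    fin_cases i <;> fin_cases j <;> simp_all [toMatrix]

instance : IsTopologicalGroup HeisenbergC where
  continuous_mul := by
    have h1 := continuous_z₁; have h2 := continuous_z₂; have h3 := continuous_z₃
    exact Continuous.prodMk (by exact (h1.comp continuous_fst).add (h1.comp continuous_snd))
      (Continuous.prodMk
        (((h2.comp continuous_fst).add (h2.comp continuous_snd)).add
          ((h1.comp continuous_fst).mul (h3.comp continuous_snd)))
        ((h3.comp continuous_fst).add (h3.comp continuous_snd)))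
  continuous_inv := by
    have h1 := continuous_z₁; have h2 := continuous_z₂; have h3 := continuous_z₃
    exact Continuous.prodMk h1.neg (Continuous.prodMk ((h1.mul h3).sub h2) h3.neg)

/-- The lattice of the matrices whose entries are (Gaussian) integers. -/
def lattice : Subgroup HeisenbergC where
  carrier := {a | a.z₁ ∈ GaussianInt.toComplex.range ∧ a.z₂ ∈ GaussianInt.toComplex.range ∧
    a.z₃ ∈ GaussianInt.toComplex.range}
  mul_mem' := fun ⟨h1, h2, h3⟩ ⟨k1, k2, k3⟩ =>
    ⟨add_mem h1 k1, add_mem (add_mem h2 k2) (mul_mem h1 k3), add_mem h3 k3⟩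
  one_mem' := ⟨zero_mem _, zero_mem _, zero_mem _⟩
  inv_mem' := fun ⟨h1, h2, h3⟩ => ⟨neg_mem h1, sub_mem (mul_mem h1 h3) h2, neg_mem h3⟩

theorem gaussianInt_eq_zero {z : ℂ} (hz : z ∈ GaussianInt.toComplex.range) (h : ‖z‖ < 1) :
    z = 0 := by
  obtain ⟨x, rfl⟩ := hz
  have h1 : Complex.normSq (x : ℂ) < 1 := by
    rw [Complex.normSq_eq_norm_sq]
    nlinarith [norm_nonneg (x : ℂ)]
  rw [← GaussianInt.intCast_real_norm] at h1
  have h2 : x.norm < 1 := by exact_mod_cast h1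
  have h3 := GaussianInt.norm_nonneg x
  have h4 : x = 0 := GaussianInt.norm_eq_zero.1 (by omega)
  simp [h4]

instance : DiscreteTopology lattice := by
  apply discreteTopology_of_isOpen_singleton_one
  have : ({1} : Set lattice) = Subtype.val ⁻¹'
      ({a : HeisenbergC | ‖a.z₁‖ < 1} ∩ {a | ‖a.z₂‖ < 1} ∩ {a | ‖a.z₃‖ < 1}) := by
    ext a
    constructor
    · rintro rfl; simp
    · rintro ⟨⟨h1, h2⟩, h3⟩
      apply Subtype.ext
      ext
      · exact gaussianInt_eq_zero a.2.1 h1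
      · exact gaussianInt_eq_zero a.2.2.1 h2
      · exact gaussianInt_eq_zero a.2.2.2 h3
  rw [this]
  exact IsOpen.preimage continuous_subtype_val
    (((isOpen_lt continuous_z₁.norm continuous_const).inter
      (isOpen_lt continuous_z₂.norm continuous_const)).inter
      (isOpen_lt continuous_z₃.norm continuous_const))

instance : ProperlyDiscontinuousSMul lattice HeisenbergC :=
  Subgroup.properlyDiscontinuousSMul_of_tendsto_cofinite lattice
    (Subgroup.tendsto_coe_cofinite_of_discrete lattice
      (isDiscrete_iff_discreteTopology.mpr (inferInstanceAs (DiscreteTopology lattice))))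

theorem contDiff_mul_left (a : HeisenbergC) :
    ContDiff ℝ ∞ (F := ℂ × ℂ × ℂ) (fun x : ℂ × ℂ × ℂ => a * mk x.1 x.2.1 x.2.2) := by
  have : (fun x : ℂ × ℂ × ℂ => a * mk x.1 x.2.1 x.2.2) =
    fun x : ℂ × ℂ × ℂ => (a.z₁ + x.1, a.z₂ + x.2.1 + a.z₁ * x.2.2, a.z₃ + x.2.2) := by
    rfl
  rw [this]
  fun_prop

end HeisenbergC

open HeisenbergC

/-- The Iwasawa manifold `Γ \ G`. -/
abbrev IwasawaManifold : Type := MulAction.orbitRel.Quotient HeisenbergC.lattice HeisenbergC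

namespace IwasawaManifold

/-- The quotient map `G → Γ \ G`. -/
def proj (a : HeisenbergC) : IwasawaManifold := Quotient.mk _ a

theorem isLocalHomeomorph_proj : IsLocalHomeomorph proj :=
  isQuotientCoveringMap_quotientMk_of_properlyDiscontinuousSMul.isCoveringMap.isLocalHomeomorph

theorem proj_eq_iff {a b : HeisenbergC} : proj a = proj b ↔ ∃ γ : lattice, (γ : HeisenbergC) * b = a :=
  Quotient.eq''

theorem mem_atlas {e : OpenPartialHomeomorph IwasawaManifold (ℂ × ℂ × ℂ)}
    (he : e ∈ atlas (ℂ × ℂ × ℂ) IwasawaManifold) :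
    ∃ a : HeisenbergC, e = (isLocalHomeomorph_proj.localInverseAt a).trans
      (chartAt (ℂ × ℂ × ℂ) a) := by
  obtain ⟨q, rfl⟩ := he
  exact ⟨_, rfl⟩

instance : T2Space IwasawaManifold := inferInstance
instance : IsManifold 𝓘(ℝ, ℂ × ℂ × ℂ) ∞ IwasawaManifold := by
  apply isManifold_of_contDiffOn
  intro e e' he he'
  obtain ⟨a, rfl⟩ := mem_atlas he
  obtain ⟨b, rfl⟩ := mem_atlas he'
  set La := isLocalHomeomorph_proj.localInverseAt a
  set Lb := isLocalHomeomorph_proj.localInverseAt b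
  intro x hx
  have hLa : ∀ y, La.symm y = proj y := fun y =>
    congrFun (isLocalHomeomorph_proj.localInverseAt_symm a) y
  have hx' : proj x ∈ Lb.source := by
    rw [← hLa x]
    exact hx.1.2.1
  have hev : ∀ᶠ y : ℂ × ℂ × ℂ in 𝓝 x, proj y ∈ Lb.source :=
    isLocalHomeomorph_proj.continuous.continuousAt.eventually_mem (Lb.open_source.mem_nhds hx')
  have hproj : ∀ y : ℂ × ℂ × ℂ, proj y ∈ Lb.source → proj (Lb (proj y)) = proj y := fun y hy =>
    isLocalHomeomorph_proj.apply_localInverseAt_of_mem hy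
  obtain ⟨γ, hγ⟩ := proj_eq_iff.1 (hproj x hx')
  have hcd := contDiff_mul_left (γ : HeisenbergC)
  have hx2 : (γ : HeisenbergC) * mk x.1 x.2.1 x.2.2 ∈ Lb.target := by
    have : mk x.1 x.2.1 x.2.2 = x := rfl
    rw [this, hγ]
    exact Lb.map_source hx'
  have hev2 : ∀ᶠ y : ℂ × ℂ × ℂ in 𝓝 x, (γ : HeisenbergC) * mk y.1 y.2.1 y.2.2 ∈ Lb.target :=
    hcd.continuous.continuousAt.eventually_mem (Lb.open_target.mem_nhds hx2)
  refine ContDiffAt.contDiffWithinAt (hcd.contDiffAt.congr_of_eventuallyEq ?_)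
  filter_upwards [hev, hev2] with y hy hy2
  change Lb (La.symm y) = (γ : HeisenbergC) * mk y.1 y.2.1 y.2.2
  refine (congrArg Lb (hLa y)).trans ?_
  refine isLocalHomeomorph_proj.injOn_localInverseAt_target (x := b) (Lb.map_source hy) hy2 ?_
  rw [hproj y hy]
  exact (proj_eq_iff.2 ⟨γ, rfl⟩).symm
end IwasawaManifold

/-! ## Almost Hermitian geometry -/

section AlmostHermitian

variable {E : Type*} [NormedAddCommGroup E] [NormedSpace ℝ E]
  {H : Type*} [TopologicalSpace H] (I : ModelWithCorners ℝ E H)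
  (M : Type*) [TopologicalSpace M] [ChartedSpace H M] [IsManifold I ∞ M]

/-- Smooth real vector fields on `M`. -/
abbrev SmoothVectorField := ContMDiffSection I E ∞ (TangentSpace I : M → Type _)

/-- A smooth section `re + i im` of the complexified tangent bundle `TM ⊗ ℂ`. -/
@[ext] structure ComplexVectorField where
  re : SmoothVectorField I M
  im : SmoothVectorField I M

/-- An almost Hermitian structure on `M`: a smooth Riemannian metric `g` and a smooth almost complex
structure `J` preserving it. The associated 2-form is `AlmostHermitianStructure.form`. -/
structure AlmostHermitianStructure where
  g : Bundle.ContMDiffRiemannianMetric I ∞ E (TangentSpace I : M → Type _)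
  J : ∀ x : M, TangentSpace I x →L[ℝ] TangentSpace I x
  J_smooth : ContMDiff I (I.prod 𝓘(ℝ, E →L[ℝ] E)) ∞
    (fun x => Bundle.TotalSpace.mk' (E →L[ℝ] E) x (J x))
  J_sq : ∀ (x : M) (v : TangentSpace I x), J x (J x v) = -v
  hermitian : ∀ (x : M) (v w : TangentSpace I x), g.inner x (J x v) (J x w) = g.inner x v w

/-- Affine connections on `M`. In Mathlib's argument order `cov Y x (X x)` is `(∇_X Y)(x)`. -/
abbrev AffineConnection := CovariantDerivative I E (TangentSpace I : M → Type _)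

variable {I M}

/-- The complex conjugate vector field. -/
def ComplexVectorField.conj (Z : ComplexVectorField I M) : ComplexVectorField I M :=
  ⟨Z.re, -Z.im⟩

/-- The complex multilinear extension of a real multilinear operation `T` on `k` vector fields,
evaluated on the complex vector fields `Z j = X j + i Y j`: expanding the product, the summand of
`s` has `Y j` in the slots `j ∈ s` and `X j` in the other slots. -/
def complexExtension {k : ℕ} (T : (Fin k → SmoothVectorField I M) → M → ℝ)
    (Z : Fin k → ComplexVectorField I M) (x : M) : ℂ :=
  ∑ s : Finset (Fin k),
    Complex.I ^ s.card * (T (fun j => if j ∈ s then (Z j).im else (Z j).re) x : ℂ)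

namespace AlmostHermitianStructure

variable (S : AlmostHermitianStructure I M)

/-- The associated almost symplectic form `ω(v, w) = g(Jv, w)`. -/
def form (x : M) (v w : TangentSpace I x) : ℝ := S.g.inner x (S.J x v) w

/-- The exterior derivative `dω(X, Y, Z)`, by the invariant formula. -/
def dForm (X Y Z : ∀ x : M, TangentSpace I x) (x : M) : ℝ :=
  mvfderiv I (fun y => S.form y (Y y) (Z y)) x (X x)
    - mvfderiv I (fun y => S.form y (X y) (Z y)) x (Y x)
    + mvfderiv I (fun y => S.form y (X y) (Y y)) x (Z x)
    - S.form x (VectorField.mlieBracket I X Y x) (Z x)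
    + S.form x (VectorField.mlieBracket I X Z x) (Y x)
    - S.form x (VectorField.mlieBracket I Y Z x) (X x)

/-- The Nijenhuis tensor `N(X, Y) = [JX, JY] - J[JX, Y] - J[X, JY] - [X, Y]`. -/
def nijenhuis (X Y : ∀ x : M, TangentSpace I x) (x : M) : TangentSpace I x :=
  VectorField.mlieBracket I (fun y => S.J y (X y)) (fun y => S.J y (Y y)) x
    - S.J x (VectorField.mlieBracket I (fun y => S.J y (X y)) Y x)
    - S.J x (VectorField.mlieBracket I X (fun y => S.J y (Y y)) x)
    - VectorField.mlieBracket I X Y x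

/-- `Z` is a section of `T^{1,0}M`, that is, `J Z = i Z` for the complex linear extension of `J`. -/
def IsType10 (Z : ComplexVectorField I M) : Prop :=
  ∀ x, S.J x (Z.re x) = -Z.im x ∧ S.J x (Z.im x) = Z.re x

/-- Quasi Kähler: the (1,2)-part of `dω` vanishes. -/
def IsQuasiKahler : Prop :=
  ∀ Z₁ Z₂ Z₃ : ComplexVectorField I M, S.IsType10 Z₁ → S.IsType10 Z₂ → S.IsType10 Z₃ → ∀ x,
    complexExtension (fun X => S.dForm (X 0) (X 1) (X 2)) ![Z₁, Z₂.conj, Z₃.conj] x = 0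

/-- Almost Kähler: `dω = 0`. -/
def IsAlmostKahler : Prop :=
  ∀ (X Y Z : SmoothVectorField I M) (x : M), S.dForm X Y Z x = 0

/-- Integrability of `J`: the Nijenhuis tensor vanishes. -/
def IsIntegrable : Prop :=
  ∀ (X Y : SmoothVectorField I M) (x : M), S.nijenhuis X Y x = 0

/-- Strictly quasi Kähler: quasi Kähler, but neither almost Kähler nor with integrable `J`
(in particular not Kähler). -/
def IsStrictlyQuasiKahler : Prop :=
  S.IsQuasiKahler ∧ ¬ S.IsAlmostKahler ∧ ¬ S.IsIntegrable

/-- `∇g = 0`: `X g(Y, Z) = g(∇_X Y, Z) + g(Y, ∇_X Z)`. -/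
def PreservesMetric (cov : AffineConnection I M) : Prop :=
  ∀ (X Y Z : SmoothVectorField I M) (x : M),
    mvfderiv I (fun y => S.g.inner y (Y y) (Z y)) x (X x) =
      S.g.inner x (cov Y x (X x)) (Z x) + S.g.inner x (Y x) (cov Z x (X x))

/-- `∇J = 0`: `∇_X (JY) = J ∇_X Y`. -/
def PreservesJ (cov : AffineConnection I M) : Prop :=
  ∀ (X Y : SmoothVectorField I M) (x : M),
    cov (fun y => S.J y (Y y)) x (X x) = S.J x (cov Y x (X x))

/-- The curvature `g(∇_X ∇_Y Z - ∇_Y ∇_X Z - ∇_[X, Y] Z, W)` of a connection. -/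
def curvature (cov : AffineConnection I M) (X Y Z W : ∀ x : M, TangentSpace I x) (x : M) : ℝ :=
  S.g.inner x
    (cov (fun y => cov Z y (Y y)) x (X x) - cov (fun y => cov Z y (X y)) x (Y x)
      - cov Z x (VectorField.mlieBracket I X Y x)) (W x)

/-- The second Gray identity (G₂) for the curvature of `cov`. -/
def SecondGrayIdentity (cov : AffineConnection I M) : Prop :=
  ∀ Z₁ Z₂ Z₃ Z₄ : ComplexVectorField I M,
    S.IsType10 Z₁ → S.IsType10 Z₂ → S.IsType10 Z₃ → S.IsType10 Z₄ → ∀ x,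
      complexExtension (fun X => S.curvature cov (X 0) (X 1) (X 2) (X 3)) ![Z₁, Z₂, Z₃, Z₄] x = 0 ∧
      complexExtension (fun X => S.curvature cov (X 0) (X 1) (X 2) (X 3))
        ![Z₁.conj, Z₂, Z₃, Z₄] x = 0

variable [FiniteDimensional ℝ E] [CompleteSpace E]

/-- `cov` is the Levi-Civita connection of `g`: metric and torsion free. -/
def IsLeviCivita (cov : AffineConnection I M) : Prop :=
  S.PreservesMetric cov ∧ ∀ x, cov.torsion x = 0

/-- `cov` is the canonical connection of `(g, J)`: it preserves `g` and `J`, and the (1,1)-part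
`(v, w) ↦ (Tor(v, w) + Tor(Jv, Jw)) / 2` of its torsion vanishes. -/
def IsCanonicalConnection (cov : AffineConnection I M) : Prop :=
  S.PreservesMetric cov ∧ S.PreservesJ cov ∧
    ∀ (x : M) (v w : TangentSpace I x),
      cov.torsion x v w + cov.torsion x (S.J x v) (S.J x w) = 0

end AlmostHermitianStructure

end AlmostHermitian

/-- The structure on `Γ \ G` is left-invariant: its pullback along the projection `G → Γ \ G` is
invariant under all left translations of `G`. -/
def IwasawaManifold.IsLeftInvariant
    (S : AlmostHermitianStructure 𝓘(ℝ, ℂ × ℂ × ℂ) IwasawaManifold) : Prop :=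
  let D (a : HeisenbergC) := mfderiv 𝓘(ℝ, ℂ × ℂ × ℂ) 𝓘(ℝ, ℂ × ℂ × ℂ) IwasawaManifold.proj a
  let L (a x : HeisenbergC) := mfderiv 𝓘(ℝ, ℂ × ℂ × ℂ) 𝓘(ℝ, ℂ × ℂ × ℂ) (fun y => a * y) x
  ∀ (a x : HeisenbergC) (v w : TangentSpace 𝓘(ℝ, ℂ × ℂ × ℂ) x),
    S.g.inner (proj (a * x)) (D (a * x) (L a x v)) (D (a * x) (L a x w)) =
        S.g.inner (proj x) (D x v) (D x w) ∧
    (S.J (proj x) (D x v) = D x w →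
      S.J (proj (a * x)) (D (a * x) (L a x v)) = D (a * x) (L a x w))

end

/-! The left-invariant vector fields descend to Γ\G and form a global frame, so tensors with
constant components in it are governed by algebra on ℂ³ with the bracket B(v, w) = (0, v₁w₃ - w₁v₃,
0) (`hasBracket_parallelization`). Take the standard inner product, and let J act as i, -i, i on the
three coordinates. B is complex bilinear in coordinates 1 and 3 and takes its values in coordinate
2, where J has the opposite sign; hence B is J-antilinear in each argument. The Levi-Civita symbol A
turns out to be J-antilinear in each argument too.

After complexification, such a bilinear map sends T^{1,0} × T^{1,0} to T^{0,1}, sends T^{0,1} ×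
T^{0,1} to T^{1,0}, and vanishes on pairs of mixed type. Since T^{1,0} is isotropic for the complex
bilinear metric, this yields (dω)^{1,2} = 0 (`HasBracket.isQuasiKahler`) and the second Gray
identity (`HasBracket.secondGrayIdentity`), while B ≠ 0 prevents ω from being closed and J from
being integrable.

Antilinearity also gives B(Jv, Jw) = -B(v, w). The flat connection making the frame parallel has
torsion -B, so it is canonical. By `eq_zero_of_canonical` every canonical connection has the same
Christoffel symbol, namely zero, and is therefore flat. -/

/-! ### Smoothness criteria for families of linear maps -/

theorem contMDiffAt_clm_of_apply {E H M F₁ F₂ : Type*} [NormedAddCommGroup E] [NormedSpace ℝ E]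
    [TopologicalSpace H] {I : ModelWithCorners ℝ E H} [TopologicalSpace M] [ChartedSpace H M]
    [NormedAddCommGroup F₁] [NormedSpace ℝ F₁] [FiniteDimensional ℝ F₁]
    [NormedAddCommGroup F₂] [NormedSpace ℝ F₂] {n : ℕ∞ω} {f : M → F₁ →L[ℝ] F₂} {x : M}
    (h : ∀ v, ContMDiffAt I 𝓘(ℝ, F₂) n (fun y => f y v) x) :
    ContMDiffAt I 𝓘(ℝ, F₁ →L[ℝ] F₂) n f x := by
  let d := Module.finrank ℝ F₁
  have hd : d = Module.finrank ℝ (Fin d → ℝ) := (Module.finrank_fin_fun ℝ).symm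
  let e₁ := ContinuousLinearEquiv.ofFinrankEq hd
  -- A basis of `F₁` turns a linear map into the tuple of its values on the basis vectors.
  let e₂ := (e₁.arrowCongr (1 : F₂ ≃L[ℝ] F₂)).trans (ContinuousLinearEquiv.piRing (Fin d))
  rw [← Function.id_comp f, ← e₂.symm_comp_self]
  exact e₂.symm.contDiff.contMDiff.contMDiffAt.comp x (contMDiffAt_pi_space.2 fun i => h _)

open Bundle in
/-- A family of linear maps between the fibres of two vector bundles is smooth if it maps smooth
sections to smooth sections. -/
theorem contMDiffAt_hom_of_apply {E H B F₁ F₂ : Type*} [NormedAddCommGroup E] [NormedSpace ℝ E]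
    [TopologicalSpace H] {I : ModelWithCorners ℝ E H} [TopologicalSpace B] [ChartedSpace H B]
    [NormedAddCommGroup F₁] [NormedSpace ℝ F₁] [FiniteDimensional ℝ F₁]
    [NormedAddCommGroup F₂] [NormedSpace ℝ F₂] {n : ℕ∞ω}
    {E₁ E₂ : B → Type*} [∀ x, AddCommGroup (E₁ x)] [∀ x, Module ℝ (E₁ x)]
    [TopologicalSpace (TotalSpace F₁ E₁)] [∀ x, TopologicalSpace (E₁ x)]
    [∀ x, AddCommGroup (E₂ x)] [∀ x, Module ℝ (E₂ x)]
    [TopologicalSpace (TotalSpace F₂ E₂)] [∀ x, TopologicalSpace (E₂ x)]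
    [FiberBundle F₁ E₁] [VectorBundle ℝ F₁ E₁] [FiberBundle F₂ E₂] [VectorBundle ℝ F₂ E₂]
    [∀ x, IsTopologicalAddGroup (E₂ x)] [∀ x, ContinuousSMul ℝ (E₂ x)]
    [ContMDiffVectorBundle n F₁ E₁ I]
    (φ : ∀ x, E₁ x →L[ℝ] E₂ x) (x₀ : B)
    (h : ∀ s : ∀ x, E₁ x, ContMDiffAt I (I.prod 𝓘(ℝ, F₁)) n (fun x => TotalSpace.mk' F₁ x (s x)) x₀ →
      ContMDiffAt I (I.prod 𝓘(ℝ, F₂)) n (fun x => TotalSpace.mk' F₂ x (φ x (s x))) x₀) :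
    ContMDiffAt I (I.prod 𝓘(ℝ, F₁ →L[ℝ] F₂)) n
      (fun x => TotalSpace.mk' (F₁ →L[ℝ] F₂) (E := fun x => E₁ x →L[ℝ] E₂ x) x (φ x)) x₀ := by
  rw [contMDiffAt_hom_bundle]
  refine ⟨contMDiffAt_id, contMDiffAt_clm_of_apply fun v => ?_⟩
  set t := trivializationAt F₁ E₁ x₀
  have ht : x₀ ∈ t.baseSet := FiberBundle.mem_baseSet_trivializationAt F₁ E₁ x₀
  -- The test sections are those that are constant in the local trivialization.
  have hs : ContMDiffAt I (I.prod 𝓘(ℝ, F₁)) n (fun x => TotalSpace.mk' F₁ x (t.symm x v)) x₀ := by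
    rw [t.contMDiffAt_section_iff ht]
    refine (contMDiffAt_const (c := v)).congr_of_eventuallyEq ?_
    filter_upwards [t.open_baseSet.mem_nhds ht] with y hy
    simp [t.apply_mk_symm hy]
  have h2 := h _ hs
  rw [contMDiffAt_section] at h2
  refine h2.congr_of_eventuallyEq ?_
  filter_upwards [t.open_baseSet.mem_nhds ht, (trivializationAt F₂ E₂ x₀).open_baseSet.mem_nhds
    (FiberBundle.mem_baseSet_trivializationAt F₂ E₂ x₀)] with y hy hy2
  rw [ContinuousLinearMap.inCoordinates_eq hy hy2]
  simp
  rfl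

/-! ### The Lie bracket as a commutator of derivations -/

section Commutator

variable {E F : Type*} [NormedAddCommGroup E] [NormedSpace ℝ E] [NormedAddCommGroup F]
  [NormedSpace ℝ F]

/-- The terms in D²f cancel by symmetry; the derivatives of `X` and `Y` that remain make up the
bracket. -/
theorem fderiv_fderiv_apply_sub {f : E → F} {X Y : E → E} {x : E} (hf : ContDiffAt ℝ 2 f x)
    (hX : DifferentiableAt ℝ X x) (hY : DifferentiableAt ℝ Y x) :
    fderiv ℝ (fun y => fderiv ℝ f y (Y y)) x (X x) - fderiv ℝ (fun y => fderiv ℝ f y (X y)) x (Y x) =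
      fderiv ℝ f x (VectorField.lieBracket ℝ X Y x) := by
  have h1 : DifferentiableAt ℝ (fderiv ℝ f) x :=
    (hf.fderiv_right (m := 1) (by norm_num)).differentiableAt (by norm_num)
  have hsymm := hf.isSymmSndFDerivAt (by simp) (X x) (Y x)
  rw [fderiv_clm_apply h1 hY, fderiv_clm_apply h1 hX]
  simp [VectorField.lieBracket, hsymm]

variable {M : Type*} [TopologicalSpace M] [ChartedSpace E M]

theorem contMDiff_mvfderiv_apply [IsManifold 𝓘(ℝ, E) ∞ M] {f : M → F} (hf : ContMDiff 𝓘(ℝ, E) 𝓘(ℝ, F) ∞ f)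
    (X : SmoothVectorField 𝓘(ℝ, E) M) :
    ContMDiff 𝓘(ℝ, E) 𝓘(ℝ, F) ∞ (fun y => mvfderiv 𝓘(ℝ, E) f y (X y)) := by
  have h1 := hf.contMDiff_tangentMap (m := ∞) (by simp)
  have h2 := h1.comp X.contMDiff
  exact (contMDiff_snd_tangentBundle_modelSpace F 𝓘(ℝ, F)).comp h2

/-- The directional derivative `Y f` in terms of the vector fields pulled back by `g`. -/
theorem mvfderiv_comp_mpullback {f : M → F} {g : E → M} {p : E} (Y : ∀ x : M, TangentSpace 𝓘(ℝ, E) x)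
    (hf : MDifferentiableAt 𝓘(ℝ, E) 𝓘(ℝ, F) f (g p))
    (hg : MDifferentiableAt 𝓘(ℝ, E) 𝓘(ℝ, E) g p)
    (hgi : (mfderiv 𝓘(ℝ, E) 𝓘(ℝ, E) g p).IsInvertible) :
    mvfderiv 𝓘(ℝ, E) f (g p) (Y (g p)) =
      fderiv ℝ (f ∘ g) p (VectorField.mpullback 𝓘(ℝ, E) 𝓘(ℝ, E) g Y p) := by
  have h1 := mfderiv_comp p hf hg
  rw [mfderiv_eq_fderiv] at h1
  have h2 : fderiv ℝ (f ∘ g) p (VectorField.mpullback 𝓘(ℝ, E) 𝓘(ℝ, E) g Y p) =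
    mfderiv 𝓘(ℝ, E) 𝓘(ℝ, F) f (g p) (mfderiv 𝓘(ℝ, E) 𝓘(ℝ, E) g p
      (VectorField.mpullback 𝓘(ℝ, E) 𝓘(ℝ, E) g Y p)) := by rw [h1]; rfl
  rw [h2, VectorField.mpullback_apply, hgi.self_apply_inverse]
  rfl

theorem mlieBracket_eq_lieBracket (X Y : E → E) :
    VectorField.mlieBracket 𝓘(ℝ, E) (M := E) X Y = VectorField.lieBracket ℝ X Y :=
  VectorField.mlieBracketWithin_univ.symm.trans
    (VectorField.mlieBracketWithin_eq_lieBracketWithin.trans VectorField.lieBracketWithin_univ)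

/-- The Lie bracket of vector fields is the commutator of the directional derivatives. -/
theorem mvfderiv_mlieBracket [CompleteSpace E] [IsManifold 𝓘(ℝ, E) ∞ M] {f : M → F}
    (hf : ContMDiff 𝓘(ℝ, E) 𝓘(ℝ, F) ∞ f)
    (X Y : SmoothVectorField 𝓘(ℝ, E) M) (x : M) :
    mvfderiv 𝓘(ℝ, E) (fun y => mvfderiv 𝓘(ℝ, E) f y (Y y)) x (X x) -
        mvfderiv 𝓘(ℝ, E) (fun y => mvfderiv 𝓘(ℝ, E) f y (X y)) x (Y x) =
      mvfderiv 𝓘(ℝ, E) f x (VectorField.mlieBracket 𝓘(ℝ, E) X Y x) := by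
  -- The inverse chart `g` transports the identity to the model space, where it is
  -- `fderiv_fderiv_apply_sub`.
  set g : E → M := fun q => (extChartAt 𝓘(ℝ, E) x).symm q with hg
  set p := extChartAt 𝓘(ℝ, E) x x with hp
  have h2 : (2 : ℕ∞ω) ≤ ∞ := by exact ENat.LEInfty.out
  have : IsManifold 𝓘(ℝ, E) (minSmoothness ℝ 2) M := by
    rw [minSmoothness_of_isRCLikeNormedField]; exact IsManifold.of_le h2
  have hgp : g p = x := by simp [hg, hp]
  have htgt : (extChartAt 𝓘(ℝ, E) x).target ∈ 𝓝 p := extChartAt_target_mem_nhds x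
  have hgs : ∀ q ∈ (extChartAt 𝓘(ℝ, E) x).target, ContMDiffAt 𝓘(ℝ, E) 𝓘(ℝ, E) ∞ g q := fun q hq =>
    (contMDiffOn_extChartAt_symm x).contMDiffAt ((isOpen_extChartAt_target x).mem_nhds hq)
  have hgd := fun q hq => (hgs q hq).mdifferentiableAt (by simp)
  have hgi : ∀ q ∈ (extChartAt 𝓘(ℝ, E) x).target, (mfderiv 𝓘(ℝ, E) 𝓘(ℝ, E) g q).IsInvertible := by
    intro q hq
    have := isInvertible_mfderivWithin_extChartAt_symm hq
    rwa [modelWithCornersSelf_coe, Set.range_id, mfderivWithin_univ] at this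
  have hfd : MDifferentiable 𝓘(ℝ, E) 𝓘(ℝ, F) f := hf.mdifferentiable (by simp)
  have hpt : p ∈ (extChartAt 𝓘(ℝ, E) x).target := mem_extChartAt_target x
  have key : ∀ Z : SmoothVectorField 𝓘(ℝ, E) M,
      (fun y => mvfderiv 𝓘(ℝ, E) f y (Z y)) ∘ g =ᶠ[𝓝 p]
        fun q => fderiv ℝ (f ∘ g) q (VectorField.mpullback 𝓘(ℝ, E) 𝓘(ℝ, E) g Z q) := fun Z => by
    filter_upwards [htgt] with q hq
    exact mvfderiv_comp_mpullback Z (hfd _) (hgd q hq) (hgi q hq)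
  have key2 : ∀ Z W : SmoothVectorField 𝓘(ℝ, E) M,
      mvfderiv 𝓘(ℝ, E) (fun y => mvfderiv 𝓘(ℝ, E) f y (Z y)) x (W x) =
        fderiv ℝ (fun q => fderiv ℝ (f ∘ g) q (VectorField.mpullback 𝓘(ℝ, E) 𝓘(ℝ, E) g Z q)) p
          (VectorField.mpullback 𝓘(ℝ, E) 𝓘(ℝ, E) g W p) := fun Z W => by
    rw [← (key Z).fderiv_eq, ← hgp]
    exact mvfderiv_comp_mpullback W ((contMDiff_mvfderiv_apply hf Z).mdifferentiable (by simp) _)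
      (hgd p hpt) (hgi p hpt)
  have hZd : ∀ Z : SmoothVectorField 𝓘(ℝ, E) M,
      DifferentiableAt ℝ (VectorField.mpullback 𝓘(ℝ, E) 𝓘(ℝ, E) g Z) p := fun Z => by
    have h1 := ContMDiffAt.mpullback_vectorField_preimage (m := 1) (n := 2)
      (Z.contMDiff.contMDiffAt.of_le (one_le_two.trans h2)) ((hgs p hpt).of_le h2)
      (hgi p hpt) (by norm_num)
    exact (contMDiffAt_vectorSpace_iff_contDiffAt.1 h1).differentiableAt (by simp)
  have hmd : ∀ Z : SmoothVectorField 𝓘(ℝ, E) M, MDifferentiableAt 𝓘(ℝ, E) 𝓘(ℝ, E).tangent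
      (fun y => (⟨y, Z y⟩ : TangentBundle 𝓘(ℝ, E) M)) (g p) := fun Z =>
    Z.contMDiff.contMDiffAt.mdifferentiableAt (by simp)
  have hfg : ContDiffAt ℝ 2 (f ∘ g) p :=
    ((hf.contMDiffAt.comp p (hgs p hpt)).of_le h2).contDiffAt
  have hb := VectorField.mpullback_mlieBracket (n := 2) (hmd X) (hmd Y) ((hgs p hpt).of_le h2)
    (by simp)
  rw [key2, key2]
  refine (fderiv_fderiv_apply_sub hfg (hZd X) (hZd Y)).trans ?_
  refine (congrArg (fderiv ℝ (f ∘ g) p)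
    ((congrFun (mlieBracket_eq_lieBracket _ _) p).symm.trans hb.symm)).trans ?_
  rw [← mvfderiv_comp_mpullback _ (hfd _) (hgd p hpt) (hgi p hpt), hgp]

end Commutator

/-! ### Parallelizations and components of vector fields -/

noncomputable section

open Bundle

variable {E : Type*} [NormedAddCommGroup E] [NormedSpace ℝ E]
  {M : Type*} [TopologicalSpace M] [ChartedSpace E M] [IsManifold 𝓘(ℝ, E) ∞ M]

variable (E M) in
/-- A smooth parallelization of a manifold: a trivialization of its tangent bundle. -/
structure Parallelization where
  frame : ∀ x : M, E ≃L[ℝ] TangentSpace 𝓘(ℝ, E) x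
  contMDiff_frame : ∀ v, ContMDiff 𝓘(ℝ, E) (𝓘(ℝ, E).prod 𝓘(ℝ, E)) ∞
    (fun x => TotalSpace.mk' E x (frame x v))

namespace Parallelization

variable (P : Parallelization E M)

/-- The vector field with constant components. -/
def field (v : E) : SmoothVectorField 𝓘(ℝ, E) M := ⟨fun x => P.frame x v, P.contMDiff_frame v⟩

@[simp] theorem field_apply (v : E) (x : M) : P.field v x = P.frame x v := rfl

/-- The components of a vector field. -/
def comp (Y : ∀ x : M, TangentSpace 𝓘(ℝ, E) x) (x : M) : E := (P.frame x).symm (Y x)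

@[simp] theorem frame_comp (Y : ∀ x : M, TangentSpace 𝓘(ℝ, E) x) (x : M) :
    P.frame x (P.comp Y x) = Y x := (P.frame x).apply_symm_apply _

theorem comp_field (v : E) : P.comp (P.field v) = fun _ => v :=
  funext fun x => (P.frame x).symm_apply_apply v

variable [FiniteDimensional ℝ E]

theorem contMDiffAt_hom_frame (x₀ : M) :
    ContMDiffAt 𝓘(ℝ, E) (𝓘(ℝ, E).prod 𝓘(ℝ, E →L[ℝ] E)) ∞ (fun x => TotalSpace.mk' (E →L[ℝ] E)
      (E := fun x : M => Bundle.Trivial M E x →L[ℝ] TangentSpace 𝓘(ℝ, E) x) x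
      (P.frame x : E →L[ℝ] TangentSpace 𝓘(ℝ, E) x)) x₀ := by
  rw [contMDiffAt_hom_bundle]
  refine ⟨contMDiffAt_id, contMDiffAt_clm_of_apply fun v => ?_⟩
  have h2 := P.contMDiff_frame v x₀
  rw [contMDiffAt_section] at h2
  refine h2.congr_of_eventuallyEq ?_
  filter_upwards [(trivializationAt E (TangentSpace 𝓘(ℝ, E)) x₀).open_baseSet.mem_nhds
    (FiberBundle.mem_baseSet_trivializationAt E (TangentSpace 𝓘(ℝ, E)) x₀)] with y hy2
  rw [ContinuousLinearMap.inCoordinates_eq (by trivial) hy2]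
  simp

/-- In local trivializations the frame is a smooth family of invertible operators, and inversion is
smooth at invertible operators. -/
theorem contMDiffAt_hom_frame_symm (x₀ : M) :
    ContMDiffAt 𝓘(ℝ, E) (𝓘(ℝ, E).prod 𝓘(ℝ, E →L[ℝ] E)) ∞ (fun x => TotalSpace.mk' (E →L[ℝ] E)
      (E := fun x : M => TangentSpace 𝓘(ℝ, E) x →L[ℝ] Bundle.Trivial M E x) x
      ((P.frame x).symm : TangentSpace 𝓘(ℝ, E) x →L[ℝ] E)) x₀ := by
  have h1 := P.contMDiffAt_hom_frame x₀
  rw [contMDiffAt_hom_bundle] at h1 ⊢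
  refine ⟨contMDiffAt_id, ?_⟩
  have hx₀ := FiberBundle.mem_baseSet_trivializationAt E (TangentSpace 𝓘(ℝ, E)) x₀
  have hinv : ContDiffAt ℝ ∞ ContinuousLinearMap.inverse
      (ContinuousLinearMap.inCoordinates E (Bundle.Trivial M E) E (TangentSpace 𝓘(ℝ, E))
        x₀ x₀ x₀ x₀ (P.frame x₀ : E →L[ℝ] TangentSpace 𝓘(ℝ, E) x₀)) := by
    apply ContinuousLinearMap.IsInvertible.contDiffAt_map_inverse
    rw [ContinuousLinearMap.inCoordinates_eq (by trivial) hx₀]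
    exact ContinuousLinearMap.isInvertible_equiv.comp
      (ContinuousLinearMap.isInvertible_equiv.comp ContinuousLinearMap.isInvertible_equiv)
  refine (hinv.contMDiffAt.comp x₀ h1.2).congr_of_eventuallyEq ?_
  filter_upwards [(trivializationAt E (TangentSpace 𝓘(ℝ, E)) x₀).open_baseSet.mem_nhds hx₀] with y hy
  dsimp only [Function.comp_apply]
  rw [ContinuousLinearMap.inCoordinates_eq (by trivial) hy,
    ContinuousLinearMap.inCoordinates_eq hy (by trivial)]
  simp only [ContinuousLinearMap.inverse_equiv_comp, ContinuousLinearMap.inverse_comp_equiv,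
    ContinuousLinearEquiv.symm_symm, ContinuousLinearMap.inverse_equiv]
  rfl

theorem contMDiffAt_comp {n : ℕ∞ω} (hn : n ≤ ∞) {Y : ∀ x : M, TangentSpace 𝓘(ℝ, E) x} {x : M} :
    ContMDiffAt 𝓘(ℝ, E) 𝓘(ℝ, E) n (P.comp Y) x ↔
    ContMDiffAt 𝓘(ℝ, E) (𝓘(ℝ, E).prod 𝓘(ℝ, E)) n (fun x => TotalSpace.mk' E x (Y x)) x := by
  constructor
  · intro h
    have h2 : ContMDiffAt 𝓘(ℝ, E) (𝓘(ℝ, E).prod 𝓘(ℝ, E)) n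
      (fun x => TotalSpace.mk' E (E := Bundle.Trivial M E) x (P.comp Y x)) x :=
        (contMDiffAt_section _).2 h
    have h3 := ContMDiffAt.clm_bundle_apply ((P.contMDiffAt_hom_frame x).of_le hn) h2
    simpa using! h3
  · intro h
    have h3 := ContMDiffAt.clm_bundle_apply ((P.contMDiffAt_hom_frame_symm x).of_le hn) h
    exact (contMDiffAt_section _).1 h3

theorem mdifferentiableAt_comp {Y : ∀ x : M, TangentSpace 𝓘(ℝ, E) x} {x : M} :
    MDifferentiableAt 𝓘(ℝ, E) 𝓘(ℝ, E) (P.comp Y) x ↔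
    MDifferentiableAt 𝓘(ℝ, E) (𝓘(ℝ, E).prod 𝓘(ℝ, E)) (fun x => TotalSpace.mk' E x (Y x)) x := by
  constructor
  · intro h
    have h2 : MDifferentiableAt 𝓘(ℝ, E) (𝓘(ℝ, E).prod 𝓘(ℝ, E))
      (fun x => TotalSpace.mk' E (E := Bundle.Trivial M E) x (P.comp Y x)) x :=
        (mdifferentiableAt_section _ _).2 h
    have h3 := MDifferentiableAt.clm_bundle_apply
      ((P.contMDiffAt_hom_frame x).mdifferentiableAt (by simp)) h2
    simpa using! h3
  · intro h
    have h3 := MDifferentiableAt.clm_bundle_apply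
      ((P.contMDiffAt_hom_frame_symm x).mdifferentiableAt (by simp)) h
    exact (mdifferentiableAt_section _ _).1 h3

end Parallelization
end

/-! ### Connections, torsion and curvature in a parallelization -/

noncomputable section

open Bundle

section Calculus

variable {E : Type*} [NormedAddCommGroup E] [NormedSpace ℝ E]
  {M : Type*} [TopologicalSpace M] [ChartedSpace E M]
  {F₁ F₂ F₃ : Type*} [NormedAddCommGroup F₁] [NormedSpace ℝ F₁] [NormedAddCommGroup F₂]
  [NormedSpace ℝ F₂] [NormedAddCommGroup F₃] [NormedSpace ℝ F₃]

theorem mvfderiv_clm_comp (L : F₁ →L[ℝ] F₂) {p : M → F₁} {x : M}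
    (hp : MDifferentiableAt 𝓘(ℝ, E) 𝓘(ℝ, F₁) p x) (v : TangentSpace 𝓘(ℝ, E) x) :
    mvfderiv 𝓘(ℝ, E) (fun y => L (p y)) x v = L (mvfderiv 𝓘(ℝ, E) p x v) := by
  have h := (L.hasFDerivAt (x := p x)).hasMFDerivAt.comp x hp.hasMFDerivAt
  have h2 := h.mfderiv
  exact congrArg (fun T : E →L[ℝ] F₂ => T v) h2

theorem mvfderiv_bilinear (L : F₁ →L[ℝ] F₂ →L[ℝ] F₃) {p : M → F₁} {q : M → F₂} {x : M}
    (hp : MDifferentiableAt 𝓘(ℝ, E) 𝓘(ℝ, F₁) p x) (hq : MDifferentiableAt 𝓘(ℝ, E) 𝓘(ℝ, F₂) q x)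
    (v : TangentSpace 𝓘(ℝ, E) x) :
    mvfderiv 𝓘(ℝ, E) (fun y => L (p y) (q y)) x v =
      L (mvfderiv 𝓘(ℝ, E) p x v) (q x) + L (p x) (mvfderiv 𝓘(ℝ, E) q x v) := by
  have hpq : HasMFDerivAt 𝓘(ℝ, E) 𝓘(ℝ, F₁ × F₂) (fun y => (p y, q y)) x
      (ContinuousLinearMap.prod (mvfderiv 𝓘(ℝ, E) p x) (mvfderiv 𝓘(ℝ, E) q x)) :=
    ⟨hp.hasMFDerivAt.1.prodMk hq.hasMFDerivAt.1, hp.hasMFDerivAt.2.prodMk hq.hasMFDerivAt.2⟩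
  have h := HasMFDerivAt.comp (f := fun y => (p y, q y)) (g := fun z : F₁ × F₂ => L z.1 z.2) x
    (L.isBoundedBilinearMap.hasFDerivAt (p x, q x)).hasMFDerivAt hpq
  have h2 := h.mfderiv
  refine (congrArg (fun T : E →L[ℝ] F₃ => T v) h2).trans ?_
  exact add_comm _ _

end Calculus

variable {E : Type*} [NormedAddCommGroup E] [NormedSpace ℝ E]
  {M : Type*} [TopologicalSpace M] [ChartedSpace E M] [IsManifold 𝓘(ℝ, E) ∞ M]

namespace Parallelization

variable (P : Parallelization E M) [FiniteDimensional ℝ E]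

theorem mdifferentiableAt_comp_smooth (Y : SmoothVectorField 𝓘(ℝ, E) M) (x : M) :
    MDifferentiableAt 𝓘(ℝ, E) 𝓘(ℝ, E) (P.comp Y) x :=
  P.mdifferentiableAt_comp.2 (Y.contMDiff.contMDiffAt.mdifferentiableAt (by simp))

theorem contMDiff_comp_smooth (Y : SmoothVectorField 𝓘(ℝ, E) M) :
    ContMDiff 𝓘(ℝ, E) 𝓘(ℝ, E) ∞ (P.comp Y) := fun _ =>
  (P.contMDiffAt_comp le_rfl).2 Y.contMDiff.contMDiffAt

/-- The connection `∇_X Y = X(Y) + A(X, Y)` in terms of the components of the vector fields. -/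
def connection (A : E →L[ℝ] E →L[ℝ] E) : AffineConnection 𝓘(ℝ, E) M where
  toFun Y x := (P.frame x : E →L[ℝ] TangentSpace 𝓘(ℝ, E) x) ∘L (mvfderiv 𝓘(ℝ, E) (P.comp Y) x +
    A.flip (P.comp Y x) ∘L ((P.frame x).symm : TangentSpace 𝓘(ℝ, E) x →L[ℝ] E))
  isCovariantDerivativeOnUniv :=
    { add := by
        intro Y Y' x hY hY' _
        have h : P.comp (Y + Y') = P.comp Y + P.comp Y' := by ext y; simp [comp]
        ext v
        simp [h, mvfderiv_add (P.mdifferentiableAt_comp.2 hY) (P.mdifferentiableAt_comp.2 hY')]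
        abel
      leibniz := by
        intro Y g x hY hg _
        have h : P.comp (g • Y) = g • P.comp Y := by ext y; simp [comp]
        ext v
        simp [h, mvfderiv_smul hg (P.mdifferentiableAt_comp.2 hY), smul_add]
        abel }

theorem connection_apply (A : E →L[ℝ] E →L[ℝ] E) (Y : ∀ x : M, TangentSpace 𝓘(ℝ, E) x) (x : M)
    (v : TangentSpace 𝓘(ℝ, E) x) :
    P.connection A Y x v =
      P.frame x (mvfderiv 𝓘(ℝ, E) (P.comp Y) x v + A ((P.frame x).symm v) (P.comp Y x)) := rfl

/-- Every connection is given by Christoffel symbols at each point. -/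
theorem exists_christoffel (cov : AffineConnection 𝓘(ℝ, E) M) (x : M) :
    ∃ A : E →ₗ[ℝ] E →ₗ[ℝ] E, ∀ Y : ∀ x : M, TangentSpace 𝓘(ℝ, E) x,
      MDifferentiableAt 𝓘(ℝ, E) (𝓘(ℝ, E).prod 𝓘(ℝ, E)) (fun x => TotalSpace.mk' E x (Y x)) x →
      ∀ v, cov Y x v =
        P.frame x (mvfderiv 𝓘(ℝ, E) (P.comp Y) x v + A ((P.frame x).symm v) (P.comp Y x)) := by
  -- The difference from the flat connection `P.connection 0` is a tensor, so it depends only on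
  -- values at `x`. Connections are controlled only on fields differentiable at the point, whence
  -- the restriction on `Y`.
  let D := cov.isCovariantDerivativeOnUniv.difference (P.connection 0).isCovariantDerivativeOnUniv x
  refine ⟨LinearMap.mk₂ ℝ (fun u w => (P.frame x).symm (D (P.frame x w) (P.frame x u)))
    (by simp) (by simp) (by simp) (by simp), fun Y hY v => ?_⟩
  have h1 : D (Y x) = cov Y x - P.connection 0 Y x :=
    IsCovariantDerivativeOn.difference_apply cov.isCovariantDerivativeOnUniv
      (P.connection 0).isCovariantDerivativeOnUniv (by trivial) hY
  have h2 := congrArg (fun T : TangentSpace 𝓘(ℝ, E) x →L[ℝ] TangentSpace 𝓘(ℝ, E) x => T v) h1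
  simp [connection_apply] at h2
  simp [h2]

/-- Structure constants of a parallelization. -/
def HasBracket (B : E →L[ℝ] E →L[ℝ] E) : Prop := ∀ (v w : E) (x : M),
  VectorField.mlieBracket 𝓘(ℝ, E) (P.field v) (P.field w) x = P.frame x (B v w)

variable {P} {B : E →L[ℝ] E →L[ℝ] E} [CompleteSpace E]

/-- The Lie bracket of two vector fields in terms of their components. -/
theorem HasBracket.mlieBracket_eq (hB : P.HasBracket B) (X Y : SmoothVectorField 𝓘(ℝ, E) M)
    (x : M) : VectorField.mlieBracket 𝓘(ℝ, E) X Y x =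
      P.frame x (mvfderiv 𝓘(ℝ, E) (P.comp Y) x (X x) - mvfderiv 𝓘(ℝ, E) (P.comp X) x (Y x) +
        B (P.comp X x) (P.comp Y x)) := by
  have h1 := (P.connection 0).torsion_apply (x := x) X.mdifferentiableAt Y.mdifferentiableAt
  have h2 := (P.connection 0).torsion_apply (x := x) (P.field (P.comp X x)).mdifferentiableAt
    (P.field (P.comp Y x)).mdifferentiableAt
  simp only [field_apply, frame_comp, connection_apply, comp_field, hB _ _ _] at h1 h2
  rw [h1] at h2
  simp [mvfderiv_const] at h2
  rw [map_add, map_sub, ← sub_eq_zero, ← neg_eq_zero, ← sub_eq_zero.2 h2]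
  abel

theorem HasBracket.torsion_eq (hB : P.HasBracket B) {cov : AffineConnection 𝓘(ℝ, E) M} {x : M}
    {A : E → E → E} (hA : ∀ v w, cov (P.field w) x (P.frame x v) = P.frame x (A v w)) (v w : E) :
    cov.torsion x (P.frame x v) (P.frame x w) = P.frame x (A v w - A w v - B v w) := by
  have h2 := cov.torsion_apply (x := x) (P.field v).mdifferentiableAt
    (P.field w).mdifferentiableAt
  simpa [hA, hB _ _ _] using h2

/-- The curvature of the connection with constant Christoffel symbols `A`. -/
theorem HasBracket.curvature_eq (hB : P.HasBracket B) {cov : AffineConnection 𝓘(ℝ, E) M}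
    {A : E →L[ℝ] E →L[ℝ] E} (hA : ∀ x, ∀ Y : ∀ x : M, TangentSpace 𝓘(ℝ, E) x,
      MDifferentiableAt 𝓘(ℝ, E) (𝓘(ℝ, E).prod 𝓘(ℝ, E)) (fun x => TotalSpace.mk' E x (Y x)) x →
      ∀ v, cov Y x v =
        P.frame x (mvfderiv 𝓘(ℝ, E) (P.comp Y) x v + A ((P.frame x).symm v) (P.comp Y x)))
    (X Y Z : SmoothVectorField 𝓘(ℝ, E) M) (x : M) :
    cov (fun y => cov Z y (Y y)) x (X x) - cov (fun y => cov Z y (X y)) x (Y x)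
      - cov Z x (VectorField.mlieBracket 𝓘(ℝ, E) X Y x) =
    P.frame x (A (P.comp X x) (A (P.comp Y x) (P.comp Z x))
      - A (P.comp Y x) (A (P.comp X x) (P.comp Z x)) - A (B (P.comp X x) (P.comp Y x)) (P.comp Z x)) := by
  have hf := P.contMDiff_comp_smooth Z
  have hd : ∀ Y : SmoothVectorField 𝓘(ℝ, E) M, MDifferentiableAt 𝓘(ℝ, E) 𝓘(ℝ, E)
      (fun y => mvfderiv 𝓘(ℝ, E) (P.comp Z) y (Y y)) x := fun Y =>
    (contMDiff_mvfderiv_apply hf Y).mdifferentiable (by simp) x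
  have hAd : ∀ Y : SmoothVectorField 𝓘(ℝ, E) M, MDifferentiableAt 𝓘(ℝ, E) 𝓘(ℝ, E)
      (fun y => A (P.comp Y y) (P.comp Z y)) x := fun Y =>
    (MDifferentiableAt.clm_apply (g := fun y => A (P.comp Y y))
      (A.contDiff.contMDiff.mdifferentiable (n := 1) (by simp) _ |>.comp x
        (P.mdifferentiableAt_comp_smooth Y x)) (P.mdifferentiableAt_comp_smooth Z x))
  have hc : ∀ Y : SmoothVectorField 𝓘(ℝ, E) M, P.comp (fun y => cov Z y (Y y)) =
      (fun y => mvfderiv 𝓘(ℝ, E) (P.comp Z) y (Y y)) + fun y => A (P.comp Y y) (P.comp Z y) := by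
    intro Y
    ext y
    rw [comp, hA y Z Z.mdifferentiableAt]
    simp [comp]
  have key : ∀ X Y : SmoothVectorField 𝓘(ℝ, E) M, cov (fun y => cov Z y (Y y)) x (X x) =
      P.frame x (mvfderiv 𝓘(ℝ, E) (fun y => mvfderiv 𝓘(ℝ, E) (P.comp Z) y (Y y)) x (X x) +
        (A (mvfderiv 𝓘(ℝ, E) (P.comp Y) x (X x)) (P.comp Z x) +
         A (P.comp Y x) (mvfderiv 𝓘(ℝ, E) (P.comp Z) x (X x))) +
        A (P.comp X x) (mvfderiv 𝓘(ℝ, E) (P.comp Z) x (Y x) + A (P.comp Y x) (P.comp Z x))) := by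
    intro X Y
    rw [hA x]
    · rw [hc, mvfderiv_add (hd Y) (hAd Y), add_apply,
        mvfderiv_bilinear A (P.mdifferentiableAt_comp_smooth Y x) (P.mdifferentiableAt_comp_smooth Z x)]
      rfl
    · apply P.mdifferentiableAt_comp.1
      rw [hc]
      exact (hd Y).add (hAd Y)
  -- The second derivatives of the components of `Z` combine into the derivative along `[X, Y]`,
  -- which cancels against the last term of the curvature; the first-order terms cancel in the final
  -- `abel`.
  rw [key, key, hA x Z Z.mdifferentiableAt, ← mvfderiv_mlieBracket hf, hB.mlieBracket_eq]
  rw [← map_sub, ← map_sub]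
  congr 1
  simp only [map_add, map_sub, add_apply, sub_apply,
    ContinuousLinearEquiv.symm_apply_apply]
  abel

end Parallelization
end

/-! ### Almost Hermitian structures with constant components -/

noncomputable section

open Bundle

variable {E : Type*} [NormedAddCommGroup E] [NormedSpace ℝ E]
  {M : Type*} [TopologicalSpace M] [ChartedSpace E M] [IsManifold 𝓘(ℝ, E) ∞ M]

variable (E) in
/-- A Hermitian structure on a real vector space. -/
structure LinearHermitianStructure where
  g : E →L[ℝ] E →L[ℝ] ℝ
  symm : ∀ v w, g v w = g w v
  pos : ∀ v, v ≠ 0 → 0 < g v v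
  isVonNBounded : Bornology.IsVonNBounded ℝ {v | g v v < 1}
  J : E →L[ℝ] E
  J_sq : ∀ v, J (J v) = -v
  hermitian : ∀ v w, g (J v) (J w) = g v w

namespace LinearHermitianStructure

variable (K : LinearHermitianStructure E)

theorem g_J_left (v w : E) : K.g (K.J v) w = -K.g v (K.J w) := by
  rw [← K.hermitian v, K.J_sq]; simp

theorem eq_of_g_eq {v w : E} (h : ∀ u, K.g v u = K.g w u) : v = w := by
  by_contra hne
  have := K.pos (v - w) (sub_ne_zero.2 hne)
  simp [h] at this

end LinearHermitianStructure

namespace Parallelization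

variable (P : Parallelization E M) (K : LinearHermitianStructure E) [FiniteDimensional ℝ E]

theorem contMDiff_smoothMetric : ContMDiff 𝓘(ℝ, E) (𝓘(ℝ, E).prod 𝓘(ℝ, E →L[ℝ] E →L[ℝ] ℝ)) ∞
    (fun x => TotalSpace.mk' (E →L[ℝ] E →L[ℝ] ℝ)
      (E := fun x : M => TangentSpace 𝓘(ℝ, E) x →L[ℝ] TangentSpace 𝓘(ℝ, E) x →L[ℝ]
        Bundle.Trivial M ℝ x) x
      (ContinuousLinearMap.precomp ℝ ((P.frame x).symm : TangentSpace 𝓘(ℝ, E) x →L[ℝ] E) ∘L K.g ∘L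
        ((P.frame x).symm : TangentSpace 𝓘(ℝ, E) x →L[ℝ] E))) := fun x₀ => by
  refine contMDiffAt_hom_of_apply (I := 𝓘(ℝ, E)) (E₁ := fun x : M => TangentSpace 𝓘(ℝ, E) x) _ _
    fun X hX => contMDiffAt_hom_of_apply (I := 𝓘(ℝ, E)) (E₁ := fun x : M => TangentSpace 𝓘(ℝ, E) x)
      (E₂ := Bundle.Trivial M ℝ) _ _ fun Y hY => ?_
  rw [contMDiffAt_section]
  exact ContMDiffAt.clm_apply (g := fun y => K.g (P.comp X y))
      (K.g.contDiff.contMDiff.contMDiffAt.comp x₀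
        ((P.contMDiffAt_comp le_rfl).2 hX)) ((P.contMDiffAt_comp le_rfl).2 hY)

/-- The almost Hermitian structure with constant components. -/
def almostHermitian : AlmostHermitianStructure 𝓘(ℝ, E) M where
  g :=
    { inner x := ContinuousLinearMap.precomp ℝ
        ((P.frame x).symm : TangentSpace 𝓘(ℝ, E) x →L[ℝ] E) ∘L K.g ∘L
        ((P.frame x).symm : TangentSpace 𝓘(ℝ, E) x →L[ℝ] E)
      symm x v w := K.symm _ _
      pos x v hv := K.pos _ (by simpa using hv)
      isVonNBounded x := by
        refine (K.isVonNBounded.image (P.frame x : E →L[ℝ] TangentSpace 𝓘(ℝ, E) x)).subset ?_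
        intro v hv
        exact ⟨(P.frame x).symm v, hv, (P.frame x).apply_symm_apply v⟩
      contMDiff := P.contMDiff_smoothMetric K }
  J x := (P.frame x : E →L[ℝ] TangentSpace 𝓘(ℝ, E) x) ∘L K.J ∘L
    ((P.frame x).symm : TangentSpace 𝓘(ℝ, E) x →L[ℝ] E)
  J_smooth := fun x₀ => by
    refine contMDiffAt_hom_of_apply (I := 𝓘(ℝ, E)) (E₁ := fun x : M => TangentSpace 𝓘(ℝ, E) x)
      (E₂ := fun x : M => TangentSpace 𝓘(ℝ, E) x) _ _ fun X hX => ?_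
    apply (P.contMDiffAt_comp le_rfl).1
    have h : P.comp (fun x => P.frame x (K.J (P.comp X x))) = fun x => K.J (P.comp X x) := by
      ext x; simp [comp]
    refine ContMDiffAt.congr_of_eventuallyEq (f := fun x => K.J (P.comp X x)) ?_
      (Filter.Eventually.of_forall fun x => congrFun h x)
    exact K.J.contDiff.contMDiff.contMDiffAt.comp x₀ ((P.contMDiffAt_comp le_rfl).2 hX)
  J_sq x v := by simp [K.J_sq]
  hermitian x v w := by
    change K.g ((P.frame x).symm (P.frame x _)) ((P.frame x).symm (P.frame x _)) = _
    simp [K.hermitian]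

theorem almostHermitian_inner (x : M) (v w : TangentSpace 𝓘(ℝ, E) x) :
    (P.almostHermitian K).g.inner x v w = K.g ((P.frame x).symm v) ((P.frame x).symm w) := rfl

theorem almostHermitian_J (x : M) (v : TangentSpace 𝓘(ℝ, E) x) :
    (P.almostHermitian K).J x v = P.frame x (K.J ((P.frame x).symm v)) := rfl

theorem almostHermitian_form (x : M) (v w : TangentSpace 𝓘(ℝ, E) x) :
    (P.almostHermitian K).form x v w =
      K.g (K.J ((P.frame x).symm v)) ((P.frame x).symm w) := by
  simp [AlmostHermitianStructure.form, almostHermitian_inner, almostHermitian_J]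

/-- The image of a smooth vector field under the almost complex structure. -/
def smoothJ (X : SmoothVectorField 𝓘(ℝ, E) M) : SmoothVectorField 𝓘(ℝ, E) M :=
  ⟨fun x => (P.almostHermitian K).J x (X x), fun x =>
    ContMDiffAt.clm_bundle_apply ((P.almostHermitian K).J_smooth x) (X.contMDiff x)⟩

theorem comp_smoothJ (X : SmoothVectorField 𝓘(ℝ, E) M) :
    P.comp (P.smoothJ K X) = fun x => K.J (P.comp X x) := by
  ext x
  change (P.frame x).symm (P.frame x _) = _
  simp [comp]

variable {P} {B : E →L[ℝ] E →L[ℝ] E} [CompleteSpace E]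

/-- The derivatives of the components cancel because ω is skew, leaving only the structure
constants. -/
theorem HasBracket.dForm_eq (hB : P.HasBracket B) (X Y Z : SmoothVectorField 𝓘(ℝ, E) M) (x : M) :
    (P.almostHermitian K).dForm X Y Z x =
      - K.g (K.J (B (P.comp X x) (P.comp Y x))) (P.comp Z x)
      + K.g (K.J (B (P.comp X x) (P.comp Z x))) (P.comp Y x)
      - K.g (K.J (B (P.comp Y x) (P.comp Z x))) (P.comp X x) := by
  have h1 : ∀ Y Z : SmoothVectorField 𝓘(ℝ, E) M, ∀ v,
      mvfderiv 𝓘(ℝ, E) (fun y => (P.almostHermitian K).form y (Y y) (Z y)) x v =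
      K.g (K.J (mvfderiv 𝓘(ℝ, E) (P.comp Y) x v)) (P.comp Z x) +
      K.g (K.J (P.comp Y x)) (mvfderiv 𝓘(ℝ, E) (P.comp Z) x v) := fun Y Z v => by
    simp only [almostHermitian_form]
    exact mvfderiv_bilinear (K.g ∘L K.J) (P.mdifferentiableAt_comp_smooth Y x)
      (P.mdifferentiableAt_comp_smooth Z x) v
  simp only [AlmostHermitianStructure.dForm, h1, hB.mlieBracket_eq]
  simp only [almostHermitian_form, ContinuousLinearEquiv.symm_apply_apply, map_add, map_sub, add_apply, sub_apply]
  have h2 : ∀ v w, K.g (K.J v) w = -K.g (K.J w) v := fun v w => by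
    rw [K.g_J_left, K.symm]
  simp only [comp]
  rw [h2 ((P.frame x).symm (Y x)), h2 ((P.frame x).symm (X x)) (mvfderiv _ _ _ _),
    h2 ((P.frame x).symm (X x)) (mvfderiv _ _ _ _)]
  ring

/-- `J` has constant components and commutes with differentiation, so all derivative terms cancel.
-/
theorem HasBracket.nijenhuis_eq (hB : P.HasBracket B) (X Y : SmoothVectorField 𝓘(ℝ, E) M) (x : M) :
    (P.almostHermitian K).nijenhuis X Y x = P.frame x (B (K.J (P.comp X x)) (K.J (P.comp Y x))
      - K.J (B (K.J (P.comp X x)) (P.comp Y x)) - K.J (B (P.comp X x) (K.J (P.comp Y x)))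
      - B (P.comp X x) (P.comp Y x)) := by
  have h1 : ∀ Y : SmoothVectorField 𝓘(ℝ, E) M, ∀ v,
      mvfderiv 𝓘(ℝ, E) (P.comp (P.smoothJ K Y)) x v = K.J (mvfderiv 𝓘(ℝ, E) (P.comp Y) x v) :=
    fun Y v => by
      rw [comp_smoothJ]
      exact mvfderiv_clm_comp K.J (P.mdifferentiableAt_comp_smooth Y x) v
  have h2 : ∀ X : SmoothVectorField 𝓘(ℝ, E) M,
    (fun y => (P.almostHermitian K).J y (X y)) = P.smoothJ K X := fun X => rfl
  simp only [AlmostHermitianStructure.nijenhuis, h2, hB.mlieBracket_eq, h1]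
  simp only [comp_smoothJ, almostHermitian_J, ContinuousLinearEquiv.symm_apply_apply, ← map_sub]
  congr 1
  simp only [map_add, map_sub, K.J_sq]
  abel

end Parallelization
end

/-! ### Uniqueness of the canonical and Levi-Civita connections -/

noncomputable section

open Bundle

namespace LinearHermitianStructure

variable {E : Type*} [NormedAddCommGroup E] [NormedSpace ℝ E] (K : LinearHermitianStructure E)

/-- A metric, complex linear Christoffel symbol with symmetric `(1,1)`-part vanishes. -/
theorem eq_zero_of_canonical (A : E →ₗ[ℝ] E →ₗ[ℝ] E)
    (hg : ∀ u v w, K.g (A u v) w + K.g v (A u w) = 0) (hJ : ∀ u v, A u (K.J v) = K.J (A u v))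
    (hT : ∀ v w, A v w + A (K.J v) (K.J w) = A w v + A (K.J w) (K.J v)) (u v : E) : A u v = 0 := by
  -- This expression C(v, w) equals `A v w + A (K.J v) (K.J w)`. It is J-linear in `w`, J-antilinear
  -- in `v`, and symmetric by `hT`, so JC = -JC and C = 0.
  have hC : ∀ v w, A v w + K.J (A (K.J v) w) = 0 := fun v w => by
    have h1 := hT v (K.J w)
    have h2 := congrArg K.J (hT v w)
    simp only [hJ, K.J_sq, map_neg, map_add, LinearMap.neg_apply] at h1 h2
    have h3 : (2 : ℝ) • K.J (A v w + K.J (A (K.J v) w)) = 0 := by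
      simp only [map_add, K.J_sq, two_smul]
      have h4 := congrArg₂ (· + ·) h1 h2
      rw [← sub_eq_zero] at h4
      rw [← h4]
      abel
    have h5 := congrArg K.J ((smul_eq_zero.1 h3).resolve_left two_ne_zero)
    simpa only [K.J_sq, map_zero, neg_eq_zero] using h5
  have hC2 : ∀ v w, A (K.J v) w = K.J (A v w) := fun v w => by
    have h := congrArg K.J (hC v w)
    rw [map_add, K.J_sq, map_zero, add_neg_eq_zero] at h
    exact h.symm
  have h0 : K.J (A u v) = 0 := K.eq_of_g_eq fun w => by
    -- `A` is now J-linear in both arguments. Moving J through the first or the second one yields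
    -- metric identities with opposite signs in the term `K.g v (K.J (A u w))`; their sum gives `K.g
    -- (K.J (A u v)) w = 0`.
    have h1 := hg (K.J u) v w
    have h2 := hg u (K.J v) w
    rw [hC2, hC2] at h1
    rw [hJ, K.g_J_left v] at h2
    simp only [map_zero, zero_apply]
    linarith
  have h := congrArg K.J h0
  simpa only [K.J_sq, map_zero, neg_eq_zero] using h

/-- A metric Christoffel symbol which is symmetric vanishes. -/
theorem eq_zero_of_symmetric (D : E → E → E) (hg : ∀ u v w, K.g (D u v) w + K.g v (D u w) = 0)
    (hT : ∀ v w, D v w = D w v) (u v : E) : D u v = 0 := K.eq_of_g_eq fun w => by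
  -- Koszul's argument: a trilinear expression skew in its last two entries and symmetric in its
  -- first two vanishes.
  have h1 := hg u v w
  have h2 := hg w v u
  have h3 := hg v u w
  rw [K.symm v, hT u w] at h1
  rw [K.symm v, hT w v] at h2
  rw [K.symm u, hT v u] at h3
  rw [hT w u] at h2
  rw [hT w u] at h1
  simp only [map_zero, zero_apply]
  linarith

end LinearHermitianStructure

variable {E : Type*} [NormedAddCommGroup E] [NormedSpace ℝ E]
  {M : Type*} [TopologicalSpace M] [ChartedSpace E M] [IsManifold 𝓘(ℝ, E) ∞ M]

namespace Parallelization

variable (P : Parallelization E M) (K : LinearHermitianStructure E) [FiniteDimensional ℝ E]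

section Christoffel

variable {P K} {cov : AffineConnection 𝓘(ℝ, E) M} {x : M} {A : E → E → E}

/-- Fields with constant components have constant inner products, so the left side of ∇g = 0
vanishes on them. -/
theorem christoffel_metric (h : (P.almostHermitian K).PreservesMetric cov)
    (hA : ∀ v w, cov (P.field w) x (P.frame x v) = P.frame x (A v w)) (u v w : E) :
    K.g (A u v) w + K.g v (A u w) = 0 := by
  have h1 := h (P.field u) (P.field v) (P.field w) x
  simp only [almostHermitian_inner, field_apply, hA, ContinuousLinearEquiv.symm_apply_apply,
    mvfderiv_const] at h1
  exact h1.symm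

theorem christoffel_J (h : (P.almostHermitian K).PreservesJ cov)
    (hA : ∀ v w, cov (P.field w) x (P.frame x v) = P.frame x (A v w)) (u v : E) :
    A u (K.J v) = K.J (A u v) := by
  have h1 := h (P.field u) (P.field v) x
  have h2 : (fun y => (P.almostHermitian K).J y (P.field v y)) = P.field (K.J v) := by
    ext y; simp [almostHermitian_J]
  rw [h2] at h1
  simpa [hA, almostHermitian_J] using h1

end Christoffel

theorem preservesMetric_connection {A : E →L[ℝ] E →L[ℝ] E}
    (hA : ∀ u v w, K.g (A u v) w + K.g v (A u w) = 0) :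
    (P.almostHermitian K).PreservesMetric (P.connection A) := fun X Y Z x => by
  have h1 := mvfderiv_bilinear K.g (P.mdifferentiableAt_comp_smooth Y x)
    (P.mdifferentiableAt_comp_smooth Z x) (X x)
  refine h1.trans ?_
  simp only [connection_apply, almostHermitian_inner, ContinuousLinearEquiv.symm_apply_apply,
    map_add, add_apply]
  have h2 := hA ((P.frame x).symm (X x)) (P.comp Y x) (P.comp Z x)
  simp only [comp] at h2 ⊢
  linarith

theorem preservesJ_connection {A : E →L[ℝ] E →L[ℝ] E} (hA : ∀ u v, A u (K.J v) = K.J (A u v)) :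
    (P.almostHermitian K).PreservesJ (P.connection A) := fun X Y x => by
  have h1 := mvfderiv_clm_comp K.J (P.mdifferentiableAt_comp_smooth Y x) (X x)
  rw [← comp_smoothJ] at h1
  change P.connection A (P.smoothJ K Y) x (X x) = _
  rw [connection_apply, connection_apply, h1, comp_smoothJ, almostHermitian_J]
  simp [hA]

variable {P} {B : E →L[ℝ] E →L[ℝ] E} [CompleteSpace E]

theorem HasBracket.connection_torsion (hB : P.HasBracket B) (A : E →L[ℝ] E →L[ℝ] E) (x : M)
    (v w : TangentSpace 𝓘(ℝ, E) x) : (P.connection A).torsion x v w =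
      P.frame x (A ((P.frame x).symm v) ((P.frame x).symm w)
        - A ((P.frame x).symm w) ((P.frame x).symm v)
        - B ((P.frame x).symm v) ((P.frame x).symm w)) := by
  have h := hB.torsion_eq (cov := P.connection A) (x := x) (A := fun v w => A v w)
    (fun v w => by simp [connection_apply, comp_field, mvfderiv_const])
    ((P.frame x).symm v) ((P.frame x).symm w)
  simpa using h

/-- The flat connection is a canonical connection if the bracket has no `(1,1)`-part. -/
theorem HasBracket.isCanonicalConnection (hB : P.HasBracket B)
    (hBJ : ∀ v w, B (K.J v) (K.J w) = -B v w) :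
    (P.almostHermitian K).IsCanonicalConnection (P.connection 0) := by
  refine ⟨P.preservesMetric_connection K (by simp), P.preservesJ_connection K (by simp),
    fun x v w => ?_⟩
  simp [hB.connection_torsion, almostHermitian_J, hBJ]

/-- By `hBJ` the bracket drops out of the (1,1)-part of the torsion. The condition on the
Christoffel symbol is then homogeneous, and `eq_zero_of_canonical` applies at each point. -/
theorem HasBracket.eq_of_isCanonicalConnection (hB : P.HasBracket B)
    (hBJ : ∀ v w, B (K.J v) (K.J w) = -B v w) {cov : AffineConnection 𝓘(ℝ, E) M}
    (h : (P.almostHermitian K).IsCanonicalConnection cov) (x : M)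
    (Y : ∀ x : M, TangentSpace 𝓘(ℝ, E) x)
    (hY : MDifferentiableAt 𝓘(ℝ, E) (𝓘(ℝ, E).prod 𝓘(ℝ, E)) (fun x => TotalSpace.mk' E x (Y x)) x)
    (v : TangentSpace 𝓘(ℝ, E) x) : cov Y x v =
      P.frame x (mvfderiv 𝓘(ℝ, E) (P.comp Y) x v +
        (0 : E →L[ℝ] E →L[ℝ] E) ((P.frame x).symm v) (P.comp Y x)) := by
  obtain ⟨A, hA⟩ := P.exists_christoffel cov x
  have hA2 : ∀ v w, cov (P.field w) x (P.frame x v) = P.frame x (A v w) := fun v w => by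
    rw [hA _ (P.field w).mdifferentiableAt]
    simp [comp_field, mvfderiv_const]
  have hA0 := K.eq_zero_of_canonical A (christoffel_metric h.1 hA2) (christoffel_J h.2.1 hA2)
    fun v w => by
      have h1 := h.2.2 x (P.frame x v) (P.frame x w)
      simp only [almostHermitian_J, ContinuousLinearEquiv.symm_apply_apply, hB.torsion_eq hA2,
        ← map_add, hBJ] at h1
      rw [← sub_eq_zero, ← (P.frame x).map_eq_zero_iff.1 h1]
      abel
  rw [hA Y hY, hA0]
  simp

theorem HasBracket.isLeviCivita (hB : P.HasBracket B) {A : E →L[ℝ] E →L[ℝ] E}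
    (hA : ∀ u v w, K.g (A u v) w + K.g v (A u w) = 0) (hT : ∀ v w, A v w - A w v = B v w) :
    (P.almostHermitian K).IsLeviCivita (P.connection A) := by
  refine ⟨P.preservesMetric_connection K hA, fun x => ?_⟩
  ext v w
  rw [hB.connection_torsion]
  simp [hT]

/-- The difference of two metric symbols with the same antisymmetrization `B` is metric and
symmetric, hence zero. -/
theorem HasBracket.eq_of_isLeviCivita (hB : P.HasBracket B) {A : E →L[ℝ] E →L[ℝ] E}
    (hA : ∀ u v w, K.g (A u v) w + K.g v (A u w) = 0) (hT : ∀ v w, A v w - A w v = B v w)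
    {cov : AffineConnection 𝓘(ℝ, E) M}
    (h : (P.almostHermitian K).IsLeviCivita cov) (x : M)
    (Y : ∀ x : M, TangentSpace 𝓘(ℝ, E) x)
    (hY : MDifferentiableAt 𝓘(ℝ, E) (𝓘(ℝ, E).prod 𝓘(ℝ, E)) (fun x => TotalSpace.mk' E x (Y x)) x)
    (v : TangentSpace 𝓘(ℝ, E) x) : cov Y x v =
      P.frame x (mvfderiv 𝓘(ℝ, E) (P.comp Y) x v + A ((P.frame x).symm v) (P.comp Y x)) := by
  obtain ⟨A', hA'⟩ := P.exists_christoffel cov x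
  have hA2 : ∀ v w, cov (P.field w) x (P.frame x v) = P.frame x (A' v w) := fun v w => by
    rw [hA' _ (P.field w).mdifferentiableAt]
    simp [comp_field, mvfderiv_const]
  have hD := K.eq_zero_of_symmetric (fun v w => A' v w - A v w) (fun u v w => by
      have h1 := christoffel_metric h.1 hA2 u v w
      have h2 := hA u v w
      simp only [map_sub, sub_apply]
      linarith) fun v w => by
    have h1 := hB.torsion_eq hA2 v w
    rw [h.2 x] at h1
    have h2 := (P.frame x).map_eq_zero_iff.1 h1.symm
    rw [← hT] at h2
    rw [← sub_eq_zero, ← h2]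
    abel
  rw [hA' Y hY, sub_eq_zero.1 (hD _ _)]

theorem HasBracket.almostHermitian_curvature_eq (hB : P.HasBracket B) {A : E →L[ℝ] E →L[ℝ] E}
    {cov : AffineConnection 𝓘(ℝ, E) M}
    (hA : ∀ x, ∀ Y : ∀ x : M, TangentSpace 𝓘(ℝ, E) x,
      MDifferentiableAt 𝓘(ℝ, E) (𝓘(ℝ, E).prod 𝓘(ℝ, E)) (fun x => TotalSpace.mk' E x (Y x)) x →
      ∀ v, cov Y x v =
        P.frame x (mvfderiv 𝓘(ℝ, E) (P.comp Y) x v + A ((P.frame x).symm v) (P.comp Y x)))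
    (X Y Z W : SmoothVectorField 𝓘(ℝ, E) M) (x : M) :
    (P.almostHermitian K).curvature cov X Y Z W x =
      K.g (A (P.comp X x) (A (P.comp Y x) (P.comp Z x))
        - A (P.comp Y x) (A (P.comp X x) (P.comp Z x))
        - A (B (P.comp X x) (P.comp Y x)) (P.comp Z x)) (P.comp W x) := by
  rw [AlmostHermitianStructure.curvature, hB.curvature_eq hA, almostHermitian_inner,
    ContinuousLinearEquiv.symm_apply_apply]
  rfl

end Parallelization

/-! ### Complex multilinear extensions and type conditions -/

section ComplexExtension

variable {E : Type*} [NormedAddCommGroup E] [NormedSpace ℝ E]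
  {H : Type*} [TopologicalSpace H] {I : ModelWithCorners ℝ E H}
  {M : Type*} [TopologicalSpace M] [ChartedSpace H M] [IsManifold I ∞ M]

theorem complexExtension_three
    (T : SmoothVectorField I M → SmoothVectorField I M → SmoothVectorField I M → M → ℝ)
    (Z₁ Z₂ Z₃ : ComplexVectorField I M) (x : M) :
    complexExtension (fun X => T (X 0) (X 1) (X 2)) ![Z₁, Z₂, Z₃] x =
      T Z₁.re Z₂.re Z₃.re x + Complex.I * (T Z₁.im Z₂.re Z₃.re x + T Z₁.re Z₂.im Z₃.re x
        + T Z₁.re Z₂.re Z₃.im x)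
      - (T Z₁.im Z₂.im Z₃.re x + T Z₁.im Z₂.re Z₃.im x + T Z₁.re Z₂.im Z₃.im x)
      - Complex.I * T Z₁.im Z₂.im Z₃.im x := by
  have hu : (Finset.univ : Finset (Finset (Fin 3))) =
    {∅, {0}, {1}, {2}, {0, 1}, {0, 2}, {1, 2}, {0, 1, 2}} := by decide
  rw [complexExtension, hu]
  repeat rw [Finset.sum_insert (by decide)]
  rw [Finset.sum_singleton]
  have h3 : Complex.I ^ 3 = -Complex.I := Complex.I_pow_three
  simp [h3]
  ring

theorem complexExtension_four (T : SmoothVectorField I M → SmoothVectorField I M →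
      SmoothVectorField I M → SmoothVectorField I M → M → ℝ)
    (Z₁ Z₂ Z₃ Z₄ : ComplexVectorField I M) (x : M) :
    complexExtension (fun X => T (X 0) (X 1) (X 2) (X 3)) ![Z₁, Z₂, Z₃, Z₄] x =
      T Z₁.re Z₂.re Z₃.re Z₄.re x
      + Complex.I * (T Z₁.im Z₂.re Z₃.re Z₄.re x + T Z₁.re Z₂.im Z₃.re Z₄.re x
        + T Z₁.re Z₂.re Z₃.im Z₄.re x + T Z₁.re Z₂.re Z₃.re Z₄.im x)
      - (T Z₁.im Z₂.im Z₃.re Z₄.re x + T Z₁.im Z₂.re Z₃.im Z₄.re x + T Z₁.im Z₂.re Z₃.re Z₄.im x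
        + T Z₁.re Z₂.im Z₃.im Z₄.re x + T Z₁.re Z₂.im Z₃.re Z₄.im x + T Z₁.re Z₂.re Z₃.im Z₄.im x)
      - Complex.I * (T Z₁.im Z₂.im Z₃.im Z₄.re x + T Z₁.im Z₂.im Z₃.re Z₄.im x
        + T Z₁.im Z₂.re Z₃.im Z₄.im x + T Z₁.re Z₂.im Z₃.im Z₄.im x)
      + T Z₁.im Z₂.im Z₃.im Z₄.im x := by
  have hu : (Finset.univ : Finset (Finset (Fin 4))) =
    {∅, {0}, {1}, {2}, {3}, {0, 1}, {0, 2}, {0, 3}, {1, 2}, {1, 3}, {2, 3}, {0, 1, 2}, {0, 1, 3},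
      {0, 2, 3}, {1, 2, 3}, {0, 1, 2, 3}} := by decide
  rw [complexExtension, hu]
  repeat rw [Finset.sum_insert (by decide)]
  rw [Finset.sum_singleton]
  have h3 : Complex.I ^ 3 = -Complex.I := Complex.I_pow_three
  have h4 : Complex.I ^ 4 = 1 := Complex.I_pow_four
  simp [h3, h4]
  ring

end ComplexExtension

namespace Parallelization

variable {P : Parallelization E M} (K : LinearHermitianStructure E)

theorem comp_neg (Y : SmoothVectorField 𝓘(ℝ, E) M) (x : M) :
    P.comp (-Y : SmoothVectorField 𝓘(ℝ, E) M) x = -P.comp Y x := by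
  simp [comp]

variable [FiniteDimensional ℝ E]

/-- A (1,0)-field is X - iJX. Substituting this turns the type conditions into real identities in X
and J. -/
theorem comp_im_of_isType10 {Z : ComplexVectorField 𝓘(ℝ, E) M}
    (hZ : (P.almostHermitian K).IsType10 Z) (x : M) : P.comp Z.im x = -K.J (P.comp Z.re x) := by
  have h := (hZ x).1
  rw [almostHermitian_J] at h
  have h2 := congrArg (P.frame x).symm h
  simp only [ContinuousLinearEquiv.symm_apply_apply, map_neg] at h2
  rw [comp, comp, h2, neg_neg]

variable {B : E →L[ℝ] E →L[ℝ] E} [CompleteSpace E]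

/-- For arguments Z₁, Z̄₂, Z̄₃ the two mixed brackets vanish, and B(Z̄₂, Z̄₃) lies in T^{1,0}, which
is ω-orthogonal to Z₁. -/
theorem HasBracket.isQuasiKahler (hB : P.HasBracket B) (hJ₁ : ∀ v w, B (K.J v) w = -K.J (B v w))
    (hJ₂ : ∀ v w, B v (K.J w) = -K.J (B v w)) : (P.almostHermitian K).IsQuasiKahler := by
  intro Z₁ Z₂ Z₃ h₁ h₂ h₃ x
  rw [complexExtension_three (fun X Y Z => (P.almostHermitian K).dForm X Y Z)]
  simp only [hB.dForm_eq, ComplexVectorField.conj, comp_neg, comp_im_of_isType10 K h₁,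
    comp_im_of_isType10 K h₂, comp_im_of_isType10 K h₃, map_neg, hJ₁, hJ₂, K.J_sq, K.g_J_left,
    neg_apply, neg_neg]
  push_cast
  ring

/-- On Z₁, Z₂, Z₃ every curvature term contains A of a mixed pair, hence vanishes. On Z̄₁, Z₂, Z₃
only A(Z̄₁, A(Z₂, Z₃)) survives; it lies in T^{1,0} and is orthogonal to Z₄. -/
theorem HasBracket.secondGrayIdentity (hB : P.HasBracket B)
    (hJ₁ : ∀ v w, B (K.J v) w = -K.J (B v w)) (hJ₂ : ∀ v w, B v (K.J w) = -K.J (B v w))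
    {A : E →L[ℝ] E →L[ℝ] E}
    (hA₁ : ∀ v w, A (K.J v) w = -K.J (A v w)) (hA₂ : ∀ v w, A v (K.J w) = -K.J (A v w))
    {cov : AffineConnection 𝓘(ℝ, E) M}
    (hA : ∀ x, ∀ Y : ∀ x : M, TangentSpace 𝓘(ℝ, E) x,
      MDifferentiableAt 𝓘(ℝ, E) (𝓘(ℝ, E).prod 𝓘(ℝ, E)) (fun x => TotalSpace.mk' E x (Y x)) x →
      ∀ v, cov Y x v =
        P.frame x (mvfderiv 𝓘(ℝ, E) (P.comp Y) x v + A ((P.frame x).symm v) (P.comp Y x))) :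
    (P.almostHermitian K).SecondGrayIdentity cov := by
  intro Z₁ Z₂ Z₃ Z₄ h₁ h₂ h₃ h₄ x
  rw [complexExtension_four (fun X Y Z W => (P.almostHermitian K).curvature cov X Y Z W),
    complexExtension_four (fun X Y Z W => (P.almostHermitian K).curvature cov X Y Z W)]
  simp only [hB.almostHermitian_curvature_eq K hA, ComplexVectorField.conj, comp_neg,
    comp_im_of_isType10 K h₁, comp_im_of_isType10 K h₂, comp_im_of_isType10 K h₃,
    comp_im_of_isType10 K h₄, map_neg, map_sub, hJ₁, hJ₂, hA₁, hA₂, K.J_sq, K.g_J_left,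
    neg_apply, sub_apply, neg_neg]
  push_cast
  constructor <;> ring

end Parallelization
end

/-! ### The left-invariant frame on the Iwasawa manifold -/

noncomputable section

open Bundle HeisenbergC

namespace IwasawaManifold

/-- The coordinate space of the Heisenberg group. -/
local notation "V" => ℂ × ℂ × ℂ

/-- The differential of a left translation by `a`, in coordinates. -/
def leftFrame (a : V) : V ≃L[ℝ] V :=
  LinearEquiv.toContinuousLinearEquiv
    { toFun v := (v.1, v.2.1 + a.1 * v.2.2, v.2.2)
      invFun v := (v.1, v.2.1 - a.1 * v.2.2, v.2.2)
      map_add' v w := by ext1; · simp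
                         ext1 <;> simp; ring
      map_smul' c v := by ext1; · simp
                          ext1 <;> simp; ring
      left_inv v := by simp
      right_inv v := by simp }

theorem leftFrame_apply (a v : V) : leftFrame a v = (v.1, v.2.1 + a.1 * v.2.2, v.2.2) := rfl

/-- Left translations in coordinates. -/
def leftMul (a y : V) : V := (a.1 + y.1, a.2.1 + y.2.1 + a.1 * y.2.2, a.2.2 + y.2.2)

theorem hasMFDerivAt_leftMul (a x : V) :
    HasMFDerivAt 𝓘(ℝ, V) 𝓘(ℝ, V) (leftMul a) x (leftFrame a : V →L[ℝ] V) := by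
  have h : leftMul a = fun y => a + leftFrame a y := by
    ext1 y
    simp only [leftMul, leftFrame_apply]
    ext1; · rfl
    ext1
    · exact add_assoc _ _ _
    · rfl
  rw [h]
  exact ((leftFrame a : V →L[ℝ] V).hasFDerivAt.const_add a).hasMFDerivAt

theorem leftFrame_leftMul (a x v : V) : leftFrame (leftMul a x) v = leftFrame a (leftFrame x v) := by
  simp only [leftFrame_apply, leftMul]
  ext1; · rfl
  ext1
  · simp; ring
  · rfl

/-- The quotient map in coordinates. -/
def coordProj (y : V) : IwasawaManifold := proj y

theorem coordProj_surjective : Function.Surjective coordProj := Quotient.mk_surjective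

theorem exists_leftMul_eq {a b : V} (h : coordProj a = coordProj b) :
    ∃ γ : V, (∀ y, coordProj (leftMul γ y) = coordProj y) ∧ leftMul γ b = a := by
  obtain ⟨γ, hγ⟩ := proj_eq_iff.1 h
  exact ⟨(γ : HeisenbergC), fun y => proj_eq_iff.2 ⟨γ, rfl⟩, hγ⟩

theorem chartAt_symm_apply (q : IwasawaManifold) (y : V) : (chartAt V q).symm y = coordProj y := by
  obtain ⟨a, ha⟩ := mem_atlas (chart_mem_atlas V q)
  rw [ha]
  exact congrFun (isLocalHomeomorph_proj.localInverseAt_symm a) y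

theorem contMDiffAt_coordProj_chartAt (q : IwasawaManifold) {y : V} (hy : y ∈ (chartAt V q).target) :
    ContMDiffAt 𝓘(ℝ, V) 𝓘(ℝ, V) ∞ coordProj y := by
  have h := (contMDiffOn_chart_symm (I := 𝓘(ℝ, V)) (n := ∞) (x := q)).contMDiffAt
    ((chartAt V q).open_target.mem_nhds hy)
  exact h.congr_of_eventuallyEq (Filter.Eventually.of_forall fun z => (chartAt_symm_apply q z).symm)

theorem coordProj_chartAt {q y : IwasawaManifold} (hy : y ∈ (chartAt V q).source) :
    coordProj (chartAt V q y) = y := by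
  rw [← chartAt_symm_apply q]
  exact (chartAt V q).left_inv hy

theorem contMDiff_leftMul (γ : V) : ContMDiff 𝓘(ℝ, V) 𝓘(ℝ, V) ∞ (leftMul γ) :=
  (contDiff_mul_left γ).contMDiff

/-- On the target of a chart the projection is the inverse chart. A lattice translation, which does
not change the projection, moves any point into such a target. -/
theorem contMDiff_coordProj : ContMDiff 𝓘(ℝ, V) 𝓘(ℝ, V) ∞ coordProj := fun a => by
  obtain ⟨γ, hγ, ha⟩ := exists_leftMul_eq (coordProj_chartAt (mem_chart_source V (coordProj a)))
  have h1 := contMDiffAt_coordProj_chartAt (coordProj a) (mem_chart_target V (coordProj a))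
  have h2 : coordProj ∘ leftMul γ = coordProj := funext hγ
  rw [← h2]
  rw [← ha] at h1
  exact h1.comp a (contMDiff_leftMul γ a)

theorem mdifferentiable_coordProj : MDifferentiable 𝓘(ℝ, V) 𝓘(ℝ, V) coordProj :=
  contMDiff_coordProj.mdifferentiable (by simp)

theorem mfderiv_coordProj_leftMul {γ : V} (hγ : ∀ y, coordProj (leftMul γ y) = coordProj y) (a v : V) :
    (mfderiv 𝓘(ℝ, V) 𝓘(ℝ, V) coordProj (leftMul γ a) (leftFrame γ v) : V) =
      mfderiv 𝓘(ℝ, V) 𝓘(ℝ, V) coordProj a v := by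
  have h2 : coordProj ∘ leftMul γ = coordProj := funext hγ
  have h3 := HasMFDerivAt.comp a (mdifferentiable_coordProj (leftMul γ a)).hasMFDerivAt
    (hasMFDerivAt_leftMul γ a)
  rw [h2] at h3
  exact congrArg (fun T : V →L[ℝ] V => T v) h3.mfderiv.symm

theorem isInvertible_mfderiv_coordProj (a : V) :
    (mfderiv 𝓘(ℝ, V) 𝓘(ℝ, V) coordProj a).IsInvertible := by
  set q := coordProj a
  obtain ⟨γ, hγ, ha⟩ := exists_leftMul_eq (coordProj_chartAt (mem_chart_source V q))
  have h1 : (mfderiv 𝓘(ℝ, V) 𝓘(ℝ, V) coordProj (leftMul γ a)).IsInvertible := by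
    have h2 := isInvertible_mfderivWithin_extChartAt_symm (mem_extChartAt_target (I := 𝓘(ℝ, V)) q)
    rw [modelWithCornersSelf_coe, Set.range_id, mfderivWithin_univ] at h2
    have h3 : ((extChartAt 𝓘(ℝ, V) q).symm : V → IwasawaManifold) = coordProj :=
      funext fun y => chartAt_symm_apply q y
    have h4 : extChartAt 𝓘(ℝ, V) q q = leftMul γ a := ha.symm
    rw [h3, h4] at h2
    exact h2
  obtain ⟨T, hT⟩ := h1
  refine ⟨(leftFrame γ).trans (T : V ≃L[ℝ] V), ?_⟩
  ext1 v
  refine Eq.trans ?_ (mfderiv_coordProj_leftMul hγ a v)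
  exact congrArg (fun T : V →L[ℝ] V => T (leftFrame γ v)) hT

/-- The isomorphism from the model space given by the left-invariant vector fields. -/
def invariantFrame (q : IwasawaManifold) : V ≃L[ℝ] TangentSpace 𝓘(ℝ, V) q :=
  (leftFrame (chartAt V q q)).trans (isInvertible_mfderiv_coordProj (chartAt V q q)).choose

/-- The frame is defined through the preimage of `q` singled out by the chart. Any other preimage
differs by a lattice element γ, and the chain rule for `coordProj ∘ leftMul γ = coordProj` shows
that the choice is immaterial. -/
theorem invariantFrame_coordProj (a v : V) : invariantFrame (coordProj a) v =
    mfderiv 𝓘(ℝ, V) 𝓘(ℝ, V) coordProj a (leftFrame a v) := by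
  obtain ⟨γ, hγ, ha⟩ := exists_leftMul_eq (coordProj_chartAt (mem_chart_source V (coordProj a)))
  have h1 := (isInvertible_mfderiv_coordProj (chartAt V (coordProj a) (coordProj a))).choose_spec
  have h2 : (invariantFrame (coordProj a) v : V) = mfderiv 𝓘(ℝ, V) 𝓘(ℝ, V) coordProj
      (chartAt V (coordProj a) (coordProj a)) (leftFrame (chartAt V (coordProj a) (coordProj a)) v) :=
    congrArg (fun T : V →L[ℝ] V => T (leftFrame (chartAt V (coordProj a) (coordProj a)) v)) h1
  refine h2.trans ?_
  rw [← ha, leftFrame_leftMul]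
  exact mfderiv_coordProj_leftMul hγ a (leftFrame a v)

theorem contMDiff_leftFrame (v : V) : ContMDiff 𝓘(ℝ, V) 𝓘(ℝ, V).tangent ∞
    (fun a : V => (⟨a, leftFrame a v⟩ : TangentBundle 𝓘(ℝ, V) V)) := fun a => by
  apply contMDiffAt_vectorSpace_iff_contDiffAt.2
  change ContDiffAt ℝ ∞ (fun a : V => (v.1, v.2.1 + a.1 * v.2.2, v.2.2)) a
  fun_prop

/-- The parallelization of the Iwasawa manifold by the left-invariant vector fields. -/
def parallelization : Parallelization V IwasawaManifold where
  frame := invariantFrame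
  contMDiff_frame v := fun q => by
    have h1 := (contMDiff_coordProj.contMDiff_tangentMap (m := ∞) (by simp)).comp
      (contMDiff_leftFrame v)
    have h2 := h1.contMDiffAt.comp q (contMDiffAt_extChartAt (I := 𝓘(ℝ, V)) (n := ∞) (x := q))
    refine h2.congr_of_eventuallyEq ?_
    filter_upwards [(chartAt V q).open_source.mem_nhds (mem_chart_source V q)] with y hy
    have h3 : ∀ a, TotalSpace.mk' V (coordProj a) (invariantFrame (coordProj a) v) =
        tangentMap 𝓘(ℝ, V) 𝓘(ℝ, V) coordProj ⟨a, leftFrame a v⟩ := fun a => by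
      rw [invariantFrame_coordProj]; rfl
    have h4 := h3 (chartAt V q y)
    rw [coordProj_chartAt hy] at h4
    exact h4

theorem parallelization_frame_coordProj (a v : V) : parallelization.frame (coordProj a) v =
    mfderiv 𝓘(ℝ, V) 𝓘(ℝ, V) coordProj a (leftFrame a v) := invariantFrame_coordProj a v

/-! ### The Heisenberg Lie algebra and its Hermitian structure -/

/-- The Lie bracket of the complex Heisenberg Lie algebra. -/
def heisenbergBracket : V →L[ℝ] V →L[ℝ] V :=
  LinearMap.toContinuousBilinearMap
    (LinearMap.mk₂ ℝ (fun v w => (0, v.1 * w.2.2 - w.1 * v.2.2, 0))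
      (fun _ _ _ => by simp; ring) (fun _ _ _ => by simp; ring) (fun _ _ _ => by simp; ring)
      (fun _ _ _ => by simp; ring))

theorem heisenbergBracket_apply (v w : V) :
    heisenbergBracket v w = (0, v.1 * w.2.2 - w.1 * v.2.2, 0) := rfl

theorem lieBracket_leftFrame (v w a : V) :
    VectorField.lieBracket ℝ (fun a => leftFrame a v) (fun a => leftFrame a w) a =
      leftFrame a (heisenbergBracket v w) := by
  have h : ∀ v a : V, HasFDerivAt (fun a => leftFrame a v)
      (ContinuousLinearMap.inr ℝ ℂ (ℂ × ℂ) ∘L ContinuousLinearMap.inl ℝ ℂ ℂ ∘L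
        (ContinuousLinearMap.mul ℝ ℂ).flip v.2.2 ∘L ContinuousLinearMap.fst ℝ ℂ (ℂ × ℂ)) a := by
    intro v a
    -- The left-invariant field is affine in `a`, with linear part a ↦ (0, a₁v₃, 0).
    have h2 : (fun a => leftFrame a v) = fun a => v +
      (ContinuousLinearMap.inr ℝ ℂ (ℂ × ℂ) ∘L ContinuousLinearMap.inl ℝ ℂ ℂ ∘L
        (ContinuousLinearMap.mul ℝ ℂ).flip v.2.2 ∘L ContinuousLinearMap.fst ℝ ℂ (ℂ × ℂ)) a := by
      ext1 a
      simp [leftFrame_apply, Prod.ext_iff, mul_comm]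
    rw [h2]
    exact (ContinuousLinearMap.hasFDerivAt _).const_add v
  rw [VectorField.lieBracket, (h v a).fderiv, (h w a).fderiv]
  simp [leftFrame_apply, heisenbergBracket_apply, Prod.ext_iff]
  ring

theorem hasBracket_parallelization : parallelization.HasBracket heisenbergBracket := by
  intro v w x
  obtain ⟨a, rfl⟩ := coordProj_surjective x
  have h2 : (2 : ℕ∞ω) ≤ ∞ := ENat.LEInfty.out
  have : IsManifold 𝓘(ℝ, V) (minSmoothness ℝ 2) IwasawaManifold := by
    rw [minSmoothness_of_isRCLikeNormedField]; exact IsManifold.of_le h2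
  have hinv := isInvertible_mfderiv_coordProj
  -- The frame fields pull back to the left-invariant fields on the group, and pullback respects
  -- brackets.
  have hp : ∀ v, VectorField.mpullback 𝓘(ℝ, V) 𝓘(ℝ, V) coordProj (parallelization.field v) =
      fun a => leftFrame a v := fun v => by
    ext1 b
    rw [VectorField.mpullback_apply, Parallelization.field_apply, parallelization_frame_coordProj]
    exact (hinv b).inverse_apply_self _
  have hb := VectorField.mpullback_mlieBracket (n := 2) (x₀ := a)
    (parallelization.field v).mdifferentiableAt (parallelization.field w).mdifferentiableAt
    ((contMDiff_coordProj a).of_le h2) (by simp)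
  rw [hp, hp] at hb
  have hb2 := hb.trans ((congrFun (mlieBracket_eq_lieBracket _ _) a).trans (lieBracket_leftFrame v w a))
  rw [VectorField.mpullback_apply] at hb2
  have hb3 := congrArg (mfderiv 𝓘(ℝ, V) 𝓘(ℝ, V) coordProj a) hb2
  rw [(hinv a).self_apply_inverse] at hb3
  rw [parallelization_frame_coordProj]
  exact hb3

/-- The standard inner product on `ℂ³`. -/
def heisenbergInner : V →L[ℝ] V →L[ℝ] ℝ :=
  LinearMap.toContinuousBilinearMap
    (LinearMap.mk₂ ℝ (fun v w => inner ℝ v.1 w.1 + inner ℝ v.2.1 w.2.1 + inner ℝ v.2.2 w.2.2)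
      (fun _ _ _ => by simp [inner_add_left]; ring) (fun _ _ _ => by simp; ring)
      (fun _ _ _ => by simp [inner_add_right]; ring)
      (fun _ _ _ => by simp; ring))

theorem heisenbergInner_apply (v w : V) : heisenbergInner v w =
    inner ℝ v.1 w.1 + inner ℝ v.2.1 w.2.1 + inner ℝ v.2.2 w.2.2 := rfl

theorem heisenbergInner_self (v : V) :
    heisenbergInner v v = ‖v.1‖ ^ 2 + ‖v.2.1‖ ^ 2 + ‖v.2.2‖ ^ 2 := by
  simp only [heisenbergInner_apply, real_inner_self_eq_norm_sq]

/-- The complex structure of `ℂ³` with the orientation of the second factor reversed. -/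
def heisenbergJ : V →L[ℝ] V :=
  LinearMap.toContinuousLinearMap
    { toFun v := (Complex.I * v.1, -(Complex.I * v.2.1), Complex.I * v.2.2)
      map_add' _ _ := by simp [mul_add, add_comm]
      map_smul' _ _ := by simp [mul_left_comm] }

theorem heisenbergJ_apply (v : V) :
    heisenbergJ v = (Complex.I * v.1, -(Complex.I * v.2.1), Complex.I * v.2.2) := rfl

theorem heisenbergJ_sq (v : V) : heisenbergJ (heisenbergJ v) = -v := by
  simp [heisenbergJ_apply, ← mul_assoc, Prod.ext_iff]

/-- The left-invariant Hermitian structure on the Lie algebra of the Heisenberg group. -/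
def heisenbergHermitian : LinearHermitianStructure V where
  g := heisenbergInner
  symm v w := by simp only [heisenbergInner_apply, real_inner_comm]
  pos v hv := by
    rw [heisenbergInner_self]
    by_contra! h
    have h1 : ‖v.1‖ ^ 2 = 0 := by nlinarith [sq_nonneg ‖v.1‖, sq_nonneg ‖v.2.1‖, sq_nonneg ‖v.2.2‖]
    have h2 : ‖v.2.1‖ ^ 2 = 0 := by nlinarith [sq_nonneg ‖v.1‖, sq_nonneg ‖v.2.1‖, sq_nonneg ‖v.2.2‖]
    have h3 : ‖v.2.2‖ ^ 2 = 0 := by nlinarith [sq_nonneg ‖v.1‖, sq_nonneg ‖v.2.1‖, sq_nonneg ‖v.2.2‖]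
    simp only [ne_eq, OfNat.ofNat_ne_zero, not_false_eq_true, pow_eq_zero_iff,
      norm_eq_zero] at h1 h2 h3
    exact hv (Prod.ext h1 (Prod.ext h2 h3))
  isVonNBounded := by
    -- The norm of `V` is the maximum of the coordinate norms, which is at most the Euclidean one.
    refine (NormedSpace.isVonNBounded_ball ℝ V 1).subset fun v hv => ?_
    rw [Set.mem_ofPred_eq, heisenbergInner_self] at hv
    rw [mem_ball_zero_iff, Prod.norm_def, Prod.norm_def, max_lt_iff, max_lt_iff]
    refine ⟨?_, ?_, ?_⟩ <;>
      nlinarith [sq_nonneg ‖v.1‖, sq_nonneg ‖v.2.1‖, sq_nonneg ‖v.2.2‖]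
  J := heisenbergJ
  J_sq := heisenbergJ_sq
  hermitian v w := by
    simp [heisenbergInner_apply, heisenbergJ_apply, Complex.inner]

/-- The Christoffel symbol of the Levi-Civita connection in the left-invariant frame. -/
def leviCivitaSymbol : V →L[ℝ] V →L[ℝ] V :=
  LinearMap.toContinuousBilinearMap
    -- Read off from the Koszul formula 2g(A(u, v), w) = g(B(u, v), w) - g(B(v, w), u) + g(B(w, u),
    -- v).
    (LinearMap.mk₂ ℝ (fun u v => ((2⁻¹ : ℝ) • (u.2.1 * star v.2.2 + v.2.1 * star u.2.2),
        (2⁻¹ : ℝ) • (u.1 * v.2.2 - v.1 * u.2.2), -(2⁻¹ : ℝ) • (u.2.1 * star v.1 + v.2.1 * star u.1)))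
      (fun _ _ _ => by ext1; · simp; ring
                       ext1 <;> simp <;> ring)
      (fun _ _ _ => by ext1; · simp; ring
                       ext1 <;> simp <;> ring)
      (fun _ _ _ => by ext1; · simp; ring
                       ext1 <;> simp <;> ring)
      (fun _ _ _ => by ext1; · simp; ring
                       ext1 <;> simp <;> ring))

theorem leviCivitaSymbol_apply (u v : V) : leviCivitaSymbol u v =
    ((2⁻¹ : ℝ) • (u.2.1 * star v.2.2 + v.2.1 * star u.2.2),
      (2⁻¹ : ℝ) • (u.1 * v.2.2 - v.1 * u.2.2),
      -(2⁻¹ : ℝ) • (u.2.1 * star v.1 + v.2.1 * star u.1)) := rfl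

theorem leviCivitaSymbol_skew (u v w : V) :
    heisenbergInner (leviCivitaSymbol u v) w + heisenbergInner v (leviCivitaSymbol u w) = 0 := by
  simp [heisenbergInner_apply, leviCivitaSymbol_apply, Complex.inner]
  ring

theorem leviCivitaSymbol_sub (v w : V) :
    leviCivitaSymbol v w - leviCivitaSymbol w v = heisenbergBracket v w := by
  rw [leviCivitaSymbol_apply, leviCivitaSymbol_apply, heisenbergBracket_apply]
  ext1
  · simp; ring
  ext1 <;> simp <;> ring

/-- Components 1 and 3 pair coordinate 2, where J is -i, with the conjugate of coordinate 1 or 3,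
where i becomes -i. Component 2 involves coordinates 1 and 3 unconjugated and acquires i. In each
case the factor is that of -J. -/
theorem leviCivitaSymbol_J_left (u v : V) :
    leviCivitaSymbol (heisenbergJ u) v = -heisenbergJ (leviCivitaSymbol u v) := by
  simp only [leviCivitaSymbol_apply, heisenbergJ_apply]
  ext1
  · simp; ring
  ext1 <;> simp <;> ring

theorem leviCivitaSymbol_J_right (u v : V) :
    leviCivitaSymbol u (heisenbergJ v) = -heisenbergJ (leviCivitaSymbol u v) := by
  simp only [leviCivitaSymbol_apply, heisenbergJ_apply]
  ext1
  · simp; ring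
  ext1 <;> simp <;> ring

theorem heisenbergBracket_J_left (v w : V) :
    heisenbergBracket (heisenbergJ v) w = -heisenbergJ (heisenbergBracket v w) := by
  rw [← leviCivitaSymbol_sub, ← leviCivitaSymbol_sub, leviCivitaSymbol_J_left,
    leviCivitaSymbol_J_right, map_sub]
  abel

theorem heisenbergBracket_J_right (v w : V) :
    heisenbergBracket v (heisenbergJ w) = -heisenbergJ (heisenbergBracket v w) := by
  rw [← leviCivitaSymbol_sub, ← leviCivitaSymbol_sub, leviCivitaSymbol_J_left,
    leviCivitaSymbol_J_right, map_sub]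
  abel

theorem heisenbergBracket_J_J (v w : V) :
    heisenbergBracket (heisenbergJ v) (heisenbergJ w) = -heisenbergBracket v w := by
  rw [heisenbergBracket_J_left, heisenbergBracket_J_right, map_neg, heisenbergJ_sq, neg_neg]

/-- The left-invariant almost Hermitian structure on the Iwasawa manifold. -/
def hermitianStructure : AlmostHermitianStructure 𝓘(ℝ, V) IwasawaManifold :=
  parallelization.almostHermitian heisenbergHermitian

theorem not_isAlmostKahler : ¬ hermitianStructure.IsAlmostKahler := fun h => by
  -- With e₁, e₂, e₃ the standard basis, B(e₁, e₃) = e₂ and ω(e₂, ie₂) = -1, while the other two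
  -- brackets vanish, so dω = 1 here.
  have h1 := h (parallelization.field (1, 0, 0)) (parallelization.field (0, 0, 1))
    (parallelization.field (0, Complex.I, 0)) (coordProj 0)
  rw [hermitianStructure, hasBracket_parallelization.dForm_eq heisenbergHermitian] at h1
  simp [Parallelization.comp_field, heisenbergBracket_apply, heisenbergHermitian,
    heisenbergInner_apply, heisenbergJ_apply] at h1

theorem not_isIntegrable : ¬ hermitianStructure.IsIntegrable := fun h => by
  -- By antilinearity the Nijenhuis tensor is -4B, and B is nonzero on this pair.
  have h1 := h (parallelization.field (1, 0, 0)) (parallelization.field (0, 0, 1)) (coordProj 0)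
  rw [hermitianStructure, hasBracket_parallelization.nijenhuis_eq heisenbergHermitian] at h1
  have h2 := (parallelization.frame (coordProj 0)).map_eq_zero_iff.1 h1
  have h3 := congrArg (fun v : V => v.2.1.re) h2
  simp [Parallelization.comp_field, heisenbergBracket_apply, heisenbergHermitian,
    heisenbergJ_apply] at h3
  norm_num at h3

/-- Left translations preserve the left-invariant frame, so a vector and its translate share the
components `u`; structures with constant components are therefore invariant. -/
theorem exists_frame_eq (a x v : V) : ∃ u : V,
    (mfderiv 𝓘(ℝ, V) 𝓘(ℝ, V) coordProj x v : V) = parallelization.frame (coordProj x) u ∧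
    (mfderiv 𝓘(ℝ, V) 𝓘(ℝ, V) coordProj (leftMul a x)
      (mfderiv 𝓘(ℝ, V) 𝓘(ℝ, V) (leftMul a) x v) : V) =
        parallelization.frame (coordProj (leftMul a x)) u := by
  refine ⟨(leftFrame x).symm v, ?_, ?_⟩
  · refine Eq.trans ?_ (parallelization_frame_coordProj x _).symm
    rw [ContinuousLinearEquiv.apply_symm_apply]
  · refine Eq.trans ?_ (parallelization_frame_coordProj (leftMul a x) _).symm
    rw [leftFrame_leftMul, ContinuousLinearEquiv.apply_symm_apply,
      (hasMFDerivAt_leftMul a x).mfderiv]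
    rfl

theorem isLeftInvariant_hermitianStructure : IsLeftInvariant hermitianStructure := by
  intro a x v w
  let D (a : HeisenbergC) := mfderiv 𝓘(ℝ, V) 𝓘(ℝ, V) proj a
  let L (a x : HeisenbergC) := mfderiv 𝓘(ℝ, V) 𝓘(ℝ, V) (fun y => a * y) x
  obtain ⟨u, hu, hu'⟩ := exists_frame_eq a x v
  obtain ⟨t, ht, ht'⟩ := exists_frame_eq a x w
  have hu₁ : D x v = parallelization.frame (proj x) u := hu
  have ht₁ : D x w = parallelization.frame (proj x) t := ht
  have hu₂ : D (a * x) (L a x v) = parallelization.frame (proj (a * x)) u := hu'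
  have ht₂ : D (a * x) (L a x w) = parallelization.frame (proj (a * x)) t := ht'
  change hermitianStructure.g.inner (proj (a * x)) (D (a * x) (L a x v)) (D (a * x) (L a x w)) =
        hermitianStructure.g.inner (proj x) (D x v) (D x w) ∧
      (hermitianStructure.J (proj x) (D x v) = D x w →
        hermitianStructure.J (proj (a * x)) (D (a * x) (L a x v)) = D (a * x) (L a x w))
  rw [hu₁, ht₁, hu₂, ht₂]
  simp only [hermitianStructure, Parallelization.almostHermitian_inner,
    Parallelization.almostHermitian_J, ContinuousLinearEquiv.symm_apply_apply, true_and]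
  intro h
  rw [(parallelization.frame (proj x)).injective h]

end IwasawaManifold

/-! ### The main theorem -/

open IwasawaManifold

theorem mainTheorem4 :
    ∃ S : AlmostHermitianStructure 𝓘(ℝ, ℂ × ℂ × ℂ) IwasawaManifold,
      S.IsStrictlyQuasiKahler ∧
      IwasawaManifold.IsLeftInvariant S ∧
      ((∃ cov : AffineConnection 𝓘(ℝ, ℂ × ℂ × ℂ) IwasawaManifold, S.IsCanonicalConnection cov) ∧
        ∀ cov : AffineConnection 𝓘(ℝ, ℂ × ℂ × ℂ) IwasawaManifold, S.IsCanonicalConnection cov →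
          ∀ (X Y Z W : SmoothVectorField 𝓘(ℝ, ℂ × ℂ × ℂ) IwasawaManifold) (x : IwasawaManifold),
            S.curvature cov X Y Z W x = 0) ∧
      ((∃ cov : AffineConnection 𝓘(ℝ, ℂ × ℂ × ℂ) IwasawaManifold, S.IsLeviCivita cov) ∧
        ∀ cov : AffineConnection 𝓘(ℝ, ℂ × ℂ × ℂ) IwasawaManifold, S.IsLeviCivita cov →
          S.SecondGrayIdentity cov) := by
  have hB := hasBracket_parallelization
  refine ⟨hermitianStructure, ⟨hB.isQuasiKahler _ heisenbergBracket_J_left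
    heisenbergBracket_J_right, not_isAlmostKahler, not_isIntegrable⟩,
    isLeftInvariant_hermitianStructure,
    ⟨⟨_, hB.isCanonicalConnection heisenbergHermitian heisenbergBracket_J_J⟩,
      fun cov hcov X Y Z W x => ?_⟩,
    ⟨_, hB.isLeviCivita heisenbergHermitian leviCivitaSymbol_skew leviCivitaSymbol_sub⟩,
    fun cov hcov => hB.secondGrayIdentity heisenbergHermitian heisenbergBracket_J_left
      heisenbergBracket_J_right leviCivitaSymbol_J_left leviCivitaSymbol_J_right
      (hB.eq_of_isLeviCivita heisenbergHermitian leviCivitaSymbol_skew leviCivitaSymbol_sub hcov)⟩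
  -- The symbol of a canonical connection is zero, so every term of its curvature is zero.
  rw [hermitianStructure, hB.almostHermitian_curvature_eq heisenbergHermitian
    (hB.eq_of_isCanonicalConnection heisenbergHermitian heisenbergBracket_J_J hcov)]
  simp
end
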